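/- Let $\alpha$ be a countable ordinal. Then there is a total function $f:[0,1]\to\mathbb{N}$ that is BSS-computable with constants and satisfies $\mathfrak{L}_R \leq_{\mathrm{W}}^c f$ for every well-founded strict partial order $R$ on $\mathbb{N}$ of rank $\alpha+1$; that is, $f \geq_{\mathrm{W}}^c \mathfrak{L}_{\alpha+1}$, where $\mathfrak{L}_{\alpha+1}$ is the common continuous Weihrauch degree of all these $\mathfrak{L}_R$. The notions are as follows. *Rank.* We write $(m,n)\in R$ for "$m$ is strictly below $n$". The rank of $n$ is $\sup\{\operatorname{rank}(m)+1 : (m,n)\in R\}$, and the rank of $R$ is $\sup\{\operatorname{rank}(n)+1 : n\in\mathbb{N}\}$. *The map* $\mathfrak{L}_R :\subseteq (\mathbb{N}\times\mathbb{N}^{\mathbb{N}})^{\mathbb{N}}\to\mathbb{N}^{\mathbb{N}}$. A sequence $(n_i,x_i)_{i\in\mathbb{N}}$ is in its domain iff for all $i$: $x_i\neq x_{i+1}$ implies $(n_{i+1},n_i)\in R$, and $x_i=x_{i+1}$ implies $n_i=n_{i+1}$. Since $R$ is well-founded, such a sequence is eventually constant, and $\mathfrak{L}_R$ returns the eventual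 value of $x_i$. *Represented spaces.* A representation of a set $X$ is a partial surjection $\delta_X :\subseteq\{0,1\}^{\mathbb{N}}\to X$; if $\delta_X(p)=x$, then $p$ is a name of $x$. The only name of $n\in\mathbb{N}$ is $0^n1^\omega$. The only name of $x\in\mathbb{N}^{\mathbb{N}}$ is $0^{x(0)}10^{x(1)}1\ldots$. Fix a standard enumeration $\nu:\mathbb{N}\to\mathbb{Q}$ of the rational numbers; the names of $x\in\mathbb{R}$ are the sequences $0^{n_0}10^{n_1}1\ldots$ with $|x-\nu(n_i)|<2^{-i}$ for all $i$. The interval $[0,1]$ carries the restriction of this representation, and finite and countable products carry the product representations obtained from the usual pairing and tupling of sequences. *Reducibility.* For a partial multivalued map $f:\subseteq X\rightrightarrows Y$ between represented spaces, a partial map $F:\subseteq\{0,1\}^{\mathbb{N}}\to\{0,1\}^{\mathbb{N}}$ realizes $f$ if, for every name $p$ of a point $x\in\operatorname{dom}(f)$, $F(p)$ is defined and is a name of an element of $f(x)$. We write $f\leq_{\mathrm{W}}^c g$ if there are continuous partial maps $K,H:\subseteq\{0,1\}^{\mathbb{N}}\to\{0,1\}^{\mathbb{N}}$ such that $p\mapsto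 K\langle p,G(H(p))\rangle$ realizes $f$ whenever $G$ realizes $g$. *BSS-computability with constants.* A machine is a finite program acting on real registers $R_0,R_1,\ldots$ and index registers $I_0,I_1,\ldots$ that hold natural numbers. Its instructions are: standard register machine operations on the index registers (set to zero, increment, decrement, copy, branch if two are equal); $R_{I_0}:=R_{I_1}$; $R_i:=a$ for any fixed $i\in\mathbb{N}$ and $a\in\mathbb{R}$; $R_0:=R_1+R_2$; $R_0:=R_1\times R_2$; branch if $R_1<R_2$; and HALT, with output $(R_0,\ldots,R_{I_0})$. On input $(v_1,\ldots,v_n)$ the machine starts with $R_k=v_k$ for $1\leq k\leq n$, $I_0=n$, and all other registers $0$. A function $f:[0,1]\to\mathbb{N}$ is BSS-computable with constants if there is a machine that halts on exactly those input tuples of real numbers that are of the form $(x)$ with $x\in[0,1]$, and that outputs $(f(x))$ on $(x)$. -/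

import Mathlib

/-! ### Cantor space and represented spaces -/

/-- Cantor space `{0,1}^ℕ` with the product topology (`false` is `0`, `true` is `1`). -/
abbrev Cantor : Type := ℕ → Bool

/-- A representation of `X`: a partial surjection from Cantor space onto `X`, given by its graph;
`Names p x` says that `p` is a name of `x`. -/
structure SpaceRep (X : Type) where
  Names : Cantor → X → Prop
  functional : ∀ p x y, Names p x → Names p y → x = y
  surjective : ∀ x, ∃ p, Names p x

namespace Cantor

/-- The pairing `⟨p, q⟩` on Cantor space: `p` on the even positions, `q` on the odd ones. -/
def pair (p q : Cantor) : Cantor :=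
  fun n => if n % 2 = 0 then p (n / 2) else q (n / 2)

def left (r : Cantor) : Cantor := fun n => r (2 * n)

def right (r : Cantor) : Cantor := fun n => r (2 * n + 1)

theorem left_pair (p q : Cantor) : left (pair p q) = p := by
  funext n
  simp [left, pair]

theorem right_pair (p q : Cantor) : right (pair p q) = q := by
  funext n
  have h1 : (2 * n + 1) % 2 = 1 := by omega
  have h2 : (2 * n + 1) / 2 = n := by omega
  simp [right, pair, h1, h2]

/-- The `i`-th component of the countable tuple `⟨p₀, p₁, …⟩` coded by `r`. -/
def proj (r : Cantor) (i : ℕ) : Cantor := fun j => r (Nat.pair i j)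

/-- The sequence `0^{x 0} 1 0^{x 1} 1 0^{x 2} 1 …`: its `k`-th `1` stands at position
`x 0 + ⋯ + x k + k`. -/
noncomputable def blocks (x : ℕ → ℕ) : Cantor :=
  fun m => by
    classical
    exact decide (∃ k, m = (∑ j ∈ Finset.range (k + 1), x j) + k)

theorem blocks_injective : Function.Injective blocks := by
  have mono : ∀ x : ℕ → ℕ, StrictMono fun k => (∑ j ∈ Finset.range (k + 1), x j) + k := by
    intro x
    refine strictMono_nat_of_lt_succ fun k => ?_
    show (∑ j ∈ Finset.range (k + 1), x j) + k < (∑ j ∈ Finset.range (k + 1 + 1), x j) + (k + 1)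
    rw [Finset.sum_range_succ _ (k + 1)]
    omega
  intro x y h
  have hr : Set.range (fun k => (∑ j ∈ Finset.range (k + 1), x j) + k)
      = Set.range (fun k => (∑ j ∈ Finset.range (k + 1), y j) + k) := by
    ext m
    have hm := congrFun h m
    simp only [blocks, decide_eq_decide] at hm
    simp only [Set.mem_range, eq_comm (b := m)]
    exact hm
  have hs := ((mono x).range_inj (mono y)).1 hr
  have hsum : ∀ k, ∑ j ∈ Finset.range (k + 1), x j = ∑ j ∈ Finset.range (k + 1), y j := by
    intro k
    have := congrFun hs k
    simpa using this
  funext k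
  cases k with
  | zero => simpa using hsum 0
  | succ k =>
    have h1 := hsum k
    have h2 := hsum (k + 1)
    rw [Finset.sum_range_succ, Finset.sum_range_succ _ (k + 1), h1] at h2
    exact Nat.add_left_cancel h2

end Cantor

namespace SpaceRep

/-- The representation of `ℕ`: the only name of `n` is `0^n 1^ω`. -/
def nat : SpaceRep ℕ where
  Names p n := p = fun i => decide (n ≤ i)
  functional := by
    rintro p m n rfl h
    have h1 := congrFun h m
    have h2 := congrFun h n
    simp at h1 h2
    omega
  surjective n := ⟨_, rfl⟩

/-- The representation of Baire space: the only name of `x` is `0^{x 0} 1 0^{x 1} 1 …`. -/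
noncomputable def baire : SpaceRep (ℕ → ℕ) where
  Names p x := p = Cantor.blocks x
  functional := by
    rintro p x y rfl h
    exact Cantor.blocks_injective h
  surjective x := ⟨_, rfl⟩

/-- An enumeration of the rational numbers (with repetitions). -/
def ratEnum (n : ℕ) : ℚ :=
  ((Equiv.intEquivNat.symm n.unpair.1 : ℤ) : ℚ) / ((n.unpair.2 : ℚ) + 1)

theorem ratEnum_surjective : Function.Surjective ratEnum := by
  intro q
  refine ⟨Nat.pair (Equiv.intEquivNat q.num) (q.den - 1), ?_⟩
  have h : ((q.den - 1 : ℕ) : ℚ) + 1 = q.den := by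
    have := q.den_pos
    exact_mod_cast Nat.sub_add_cancel this
  have h2 := Equiv.symm_apply_apply Equiv.intEquivNat q.num
  simp only [ratEnum, Nat.unpair_pair, h, h2]
  exact Rat.num_div_den q

/-- The standard representation of `ℝ`: a name of `x` is a sequence `0^{n 0} 1 0^{n 1} 1 …` such
that the `n i`-th rational number has distance less than `2^{-i}` from `x`. -/
noncomputable def real : SpaceRep ℝ where
  Names p x := ∃ n : ℕ → ℕ, p = Cantor.blocks n ∧ ∀ i, |x - (ratEnum (n i) : ℝ)| < (2⁻¹ : ℝ) ^ i
  functional := by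
    rintro p x y ⟨n, rfl, hn⟩ ⟨m, hm', hm⟩
    obtain rfl := Cantor.blocks_injective hm'
    have hlim : Filter.Tendsto (fun i : ℕ => (2⁻¹ : ℝ) ^ i) Filter.atTop (nhds 0) :=
      tendsto_pow_atTop_nhds_zero_of_lt_one (by norm_num) (by norm_num)
    have key : ∀ z : ℝ, (∀ i, |z - (ratEnum (n i) : ℝ)| < (2⁻¹ : ℝ) ^ i) →
        Filter.Tendsto (fun i => (ratEnum (n i) : ℝ)) Filter.atTop (nhds z) := by
      intro z hz
      rw [tendsto_iff_dist_tendsto_zero]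
      refine squeeze_zero (fun _ => dist_nonneg) (fun i => ?_) hlim
      rw [dist_comm, Real.dist_eq]
      exact (hz i).le
    exact tendsto_nhds_unique (key x hn) (key y hm)
  surjective := by
    intro x
    have h : ∀ i : ℕ, ∃ n : ℕ, |x - (ratEnum n : ℝ)| < (2⁻¹ : ℝ) ^ i := by
      intro i
      have hpos : (0 : ℝ) < (2⁻¹ : ℝ) ^ i := by positivity
      obtain ⟨q, hq1, hq2⟩ := exists_rat_btwn (show x < x + (2⁻¹ : ℝ) ^ i by linarith)
      obtain ⟨n, rfl⟩ := ratEnum_surjective q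
      refine ⟨n, ?_⟩
      rw [abs_lt]
      constructor <;> linarith
    choose n hn using h
    exact ⟨_, n, rfl, hn⟩

/-- Subspaces: restrict the representation to the names of points of the subset. -/
def subspace {X : Type} (δ : SpaceRep X) (S : Set X) : SpaceRep S where
  Names p x := δ.Names p x
  functional p x y hx hy := Subtype.ext (δ.functional p x y hx hy)
  surjective x := δ.surjective x

/-- Binary products: `⟨p, q⟩` names `(x, y)` if `p` names `x` and `q` names `y`. -/
def prod {X Y : Type} (δ : SpaceRep X) (ε : SpaceRep Y) : SpaceRep (X × Y) where
  Names r z := δ.Names r.left z.1 ∧ ε.Names r.right z.2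
  functional r z w hz hw :=
    Prod.ext (δ.functional _ _ _ hz.1 hw.1) (ε.functional _ _ _ hz.2 hw.2)
  surjective z := by
    obtain ⟨p, hp⟩ := δ.surjective z.1
    obtain ⟨q, hq⟩ := ε.surjective z.2
    refine ⟨Cantor.pair p q, ?_, ?_⟩
    · rwa [Cantor.left_pair]
    · rwa [Cantor.right_pair]

/-- Countable powers: `⟨p₀, p₁, …⟩` names `(x₀, x₁, …)` if each `pᵢ` names `xᵢ`. -/
def seq {X : Type} (δ : SpaceRep X) : SpaceRep (ℕ → X) where
  Names r x := ∀ i, δ.Names (r.proj i) (x i)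
  functional r x y hx hy := funext fun i => δ.functional _ _ _ (hx i) (hy i)
  surjective x := by
    choose p hp using fun i => δ.surjective (x i)
    refine ⟨fun n => p n.unpair.1 n.unpair.2, fun i => ?_⟩
    have h : Cantor.proj (fun n => p n.unpair.1 n.unpair.2) i = p i := by
      funext j
      simp [Cantor.proj]
    rw [h]
    exact hp i

end SpaceRep

/-! ### Continuous Weihrauch reducibility

A partial multivalued function from `X` to `Y` is a relation `f : X → Y → Prop`; its domain consists
of the `x` with `f x y` for some `y`. -/

/-- The partial function `F` on Cantor space is a realizer of `f`. -/
def Realizes {X Y : Type} (δX : SpaceRep X) (δY : SpaceRep Y)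
    (F : Cantor →. Cantor) (f : X → Y → Prop) : Prop :=
  ∀ p x, δX.Names p x → (∃ y, f x y) → ∃ q ∈ F p, ∃ y, δY.Names q y ∧ f x y

/-- A partial function on Cantor space is continuous if it is continuous on its domain, which
carries the subspace topology. -/
def PartialContinuous (F : Cantor →. Cantor) : Prop :=
  Continuous F.asSubtype

/-- `f ≤_W^c g`: there are continuous partial functions `K`, `H` on Cantor space such that
`K⟨id, G H⟩` is a realizer of `f` for every realizer `G` of `g`. -/
def ContWeihrauchLE {X Y Z W : Type}
    (δX : SpaceRep X) (δY : SpaceRep Y) (f : X → Y → Prop)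
    (δZ : SpaceRep Z) (δW : SpaceRep W) (g : Z → W → Prop) : Prop :=
  ∃ K H : Cantor →. Cantor, PartialContinuous K ∧ PartialContinuous H ∧
    ∀ G : Cantor →. Cantor, Realizes δZ δW G g →
      Realizes δX δY
        (fun p => (H p).bind fun r => (G r).bind fun q => K (Cantor.pair p q)) f

/-! ### Limits of sequences with mind changes bounded by a well-founded order -/

/-- The domain of `𝔏_R`: `R a b` means that `a` is strictly below `b`. -/
def LimDom (R : ℕ → ℕ → Prop) (s : ℕ → ℕ × (ℕ → ℕ)) : Prop :=
  ∀ i, ((s i).2 ≠ (s (i + 1)).2 → R (s (i + 1)).1 (s i).1) ∧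
    ((s i).2 = (s (i + 1)).2 → (s i).1 = (s (i + 1)).1)

/-- `𝔏_R`, mapping a sequence in its domain to the value at which the second components
stabilize. -/
def LimR (R : ℕ → ℕ → Prop) (s : ℕ → ℕ × (ℕ → ℕ)) (y : ℕ → ℕ) : Prop :=
  LimDom R s ∧ ∃ N, ∀ i, N ≤ i → (s i).2 = y

/-- The rank of a well-founded relation on `ℕ`: the least ordinal greater than the ranks of all its
elements. -/
noncomputable def relRank (R : ℕ → ℕ → Prop) [IsWellFounded ℕ R] : Ordinal.{0} :=
  ⨆ n : ℕ, Order.succ (IsWellFounded.rank R n)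

/-- Every countable successor ordinal is the rank of a well-founded strict partial order
on `ℕ`. -/
theorem exists_relRank_eq (α : Ordinal.{0}) (hα : α.card ≤ Cardinal.aleph0) :
    ∃ (R : ℕ → ℕ → Prop) (_ : IsTrans ℕ R) (_ : IsWellFounded ℕ R), relRank R = α + 1 := by
  have hc : (Set.Iio (α + 1)).Countable := by
    rw [← Cardinal.le_aleph0_iff_set_countable, Cardinal.mk_Iio_ordinal, Cardinal.lift_le_aleph0]
    simpa using hα
  obtain ⟨f, hf⟩ := hc.exists_eq_range ⟨α, by simp⟩
  have hlt : ∀ n, f n < α + 1 := fun n => by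
    have : f n ∈ Set.Iio (α + 1) := hf ▸ Set.mem_range_self n
    exact this
  have hex : ∀ o, o < α + 1 → ∃ n, f n = o := fun o ho => by
    have : o ∈ Set.range f := hf ▸ ho
    exact this
  let R : ℕ → ℕ → Prop := fun m n => f m < f n
  have hT : IsTrans ℕ R := ⟨fun _ _ _ h1 h2 => lt_trans (α := Ordinal) h1 h2⟩
  have hW : IsWellFounded ℕ R := ⟨InvImage.wf f (wellFounded_lt (α := Ordinal))⟩
  refine ⟨R, hT, hW, ?_⟩
  have hrank : ∀ n, IsWellFounded.rank R n = f n := by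
    intro n
    refine hW.wf.induction (C := fun n => IsWellFounded.rank R n = f n) n fun n ih => ?_
    rw [IsWellFounded.rank_eq]
    apply le_antisymm
    · rw [Ordinal.iSup_le_iff]
      rintro ⟨m, hm⟩
      rw [ih m hm]
      exact Order.succ_le_of_lt hm
    · refine le_of_forall_lt fun o ho => ?_
      obtain ⟨m, rfl⟩ := hex o (ho.trans (hlt n))
      rw [Ordinal.lt_iSup_iff]
      exact ⟨⟨m, ho⟩, by rw [ih m ho]; exact Order.lt_succ _⟩
  unfold relRank
  simp only [hrank]
  apply le_antisymm
  · rw [Ordinal.iSup_le_iff]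
    exact fun n => Order.succ_le_of_lt (hlt n)
  · obtain ⟨n, hn⟩ := hex α (by simp)
    have := Ordinal.le_iSup (fun n => Order.succ (f n)) n
    simpa [hn] using this

/-! ### BSS machines: register machines over `(ℝ, +, ×, <)` with real constants -/

/-- The instructions. `R_k` are the real registers, `I_k` the index registers (holding natural
numbers), `l` is a line of the program. -/
inductive BSSInstr : Type
  /-- `I_i := 0` -/
  | idxZero (i : ℕ)
  /-- `I_i := I_i + 1` -/
  | idxSucc (i : ℕ)
  /-- `I_i := I_i - 1` (and `0` if `I_i = 0`) -/
  | idxPred (i : ℕ)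
  /-- `I_i := I_j` -/
  | idxCopy (i j : ℕ)
  /-- if `I_i = I_j` then go to line `l` -/
  | idxBranch (i j l : ℕ)
  /-- `R_{I_0} := R_{I_1}` -/
  | copy
  /-- `R_i := a` -/
  | const (i : ℕ) (a : ℝ)
  /-- `R_0 := R_1 + R_2` -/
  | add
  /-- `R_0 := R_1 * R_2` -/
  | mul
  /-- if `R_1 < R_2` then go to line `l` -/
  | branchLT (l : ℕ)
  /-- stop with output `R_0, …, R_{I_0}` -/
  | halt

/-- A program is a finite list of instructions; its first line is line `0`. -/
abbrev BSSProgram : Type := List BSSInstr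

structure BSSConfig where
  line : ℕ
  idx : ℕ → ℕ
  reg : ℕ → ℝ

namespace BSSProgram

/-- The effect of one instruction. -/
noncomputable def exec (ins : BSSInstr) (c : BSSConfig) : BSSConfig :=
  match ins with
  | .idxZero i => ⟨c.line + 1, Function.update c.idx i 0, c.reg⟩
  | .idxSucc i => ⟨c.line + 1, Function.update c.idx i (c.idx i + 1), c.reg⟩
  | .idxPred i => ⟨c.line + 1, Function.update c.idx i (c.idx i - 1), c.reg⟩
  | .idxCopy i j => ⟨c.line + 1, Function.update c.idx i (c.idx j), c.reg⟩
  | .idxBranch i j l => ⟨if c.idx i = c.idx j then l else c.line + 1, c.idx, c.reg⟩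
  | .copy => ⟨c.line + 1, c.idx, Function.update c.reg (c.idx 0) (c.reg (c.idx 1))⟩
  | .const i a => ⟨c.line + 1, c.idx, Function.update c.reg i a⟩
  | .add => ⟨c.line + 1, c.idx, Function.update c.reg 0 (c.reg 1 + c.reg 2)⟩
  | .mul => ⟨c.line + 1, c.idx, Function.update c.reg 0 (c.reg 1 * c.reg 2)⟩
  | .branchLT l => by
      classical
      exact ⟨if c.reg 1 < c.reg 2 then l else c.line + 1, c.idx, c.reg⟩
  | .halt => c

/-- One step of the machine. If the current line does not exist, the configuration does not change
any more, and the machine does not halt. -/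
noncomputable def step (M : BSSProgram) (c : BSSConfig) : BSSConfig :=
  match M[c.line]? with
  | some ins => exec ins c
  | none => c

/-- The initial configuration on input `v = (v_1, …, v_n)`: `I_0 = n`, all other index registers
are `0`, `R_k = v_k` for `1 ≤ k ≤ n`, all other real registers are `0`. -/
def init (v : List ℝ) : BSSConfig where
  line := 0
  idx := fun k => if k = 0 then v.length else 0
  reg := fun k => if k = 0 then 0 else v.getD (k - 1) 0

/-- On input `v`, the machine eventually halts, with output `w`. -/
def Outputs (M : BSSProgram) (v w : List ℝ) : Prop :=
  ∃ t : ℕ, M[((step M)^[t] (init v)).line]? = some BSSInstr.halt ∧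
    w = (List.range (((step M)^[t] (init v)).idx 0 + 1)).map ((step M)^[t] (init v)).reg

end BSSProgram

/-- The function `f : [0,1] → ℕ` is BSS-computable with constants: some machine halts exactly on
the one-element tuples `(x)` with `x ∈ [0,1]`, and its output there is `(f x)`. -/
def BSSComputable (f : Set.Icc (0 : ℝ) 1 → ℕ) : Prop :=
  ∃ M : BSSProgram, ∀ v w : List ℝ,
    M.Outputs v w ↔ ∃ x : Set.Icc (0 : ℝ) 1, v = [(x : ℝ)] ∧ w = [(f x : ℝ)]

/-! Read a binary prefix of `x` as an integer with an extra leading 1, so that its length is its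
binary logarithm. Label every digit position by an ordinal at most `α + 1`, in such a way that each
ordinal up to `α` is the label of suitable positions arbitrarily far out. Let `f x` be the shortest
prefix of `x` at which either only zeros remain or the labels of the digits 1 fail to decrease. Such
a prefix exists: otherwise `x` would have infinitely many digits 1 with decreasing labels
(`exists_searchStops`).

`f` is BSS-computable because one real constant can hold the whole set of prefixes with decreasing
labels as ternary digits, computable or not. The machine doubles `1 + x` and consults this oracle at
each integer part (`prefixSearch_loop`).

For the reduction, a sequence in the domain of the limit map is turned into a dyadic number. Each
mind change puts a digit 1 at a later position that codes the stage and the rank of the current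
index, so labels decrease with the ranks. Later digits only change the number slightly, which makes
a name of it continuously available (`real_names_marksIndex`). On this number `f` stops exactly at
the last digit 1 (`searchStops_dyadic`), whose position reveals the stage of the last mind change.
The labelling depends on `α` only; `R` enters just through the codes of its ranks, so one `f` serves
all `R`. -/

/-! ### Running BSS programs: straight-line blocks, comparisons and jumps -/

namespace BSSProgram

/-- From `c` the machine `M` eventually reaches a configuration with property `P`. -/
def Reaches (M : BSSProgram) (c : BSSConfig) (P : BSSConfig → Prop) : Prop :=
  ∃ t : ℕ, P ((step M)^[t] c)

theorem Reaches.refl {M : BSSProgram} {c : BSSConfig} {P : BSSConfig → Prop} (h : P c) :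
    Reaches M c P := ⟨0, h⟩

theorem Reaches.trans {M : BSSProgram} {c : BSSConfig} {P Q : BSSConfig → Prop}
    (h : Reaches M c P) (hPQ : ∀ c', P c' → Reaches M c' Q) : Reaches M c Q := by
  obtain ⟨t, ht⟩ := h
  obtain ⟨t', ht'⟩ := hPQ _ ht
  exact ⟨t' + t, by rwa [Function.iterate_add_apply]⟩

theorem step_eq_exec {M : BSSProgram} {c : BSSConfig} {ins : BSSInstr}
    (h : M[c.line]? = some ins) : step M c = exec ins c := by
  simp [step, h]

theorem step_eq_self_of_halt {M : BSSProgram} {c : BSSConfig}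
    (h : M[c.line]? = some BSSInstr.halt) : step M c = c := by
  rw [step_eq_exec h]
  rfl

/-- An orbit never leaves a fixed point, so it meets at most one. Halting configurations are fixed,
hence outputs are unique; and a machine caught at a fixed point that is not halting has no output.
-/
theorem iterate_eq_of_fixed {M : BSSProgram} {c : BSSConfig} {s t : ℕ}
    (hs : step M ((step M)^[s] c) = (step M)^[s] c)
    (ht : step M ((step M)^[t] c) = (step M)^[t] c) :
    (step M)^[s] c = (step M)^[t] c := by
  have h : ∀ a b, step M ((step M)^[a] c) = (step M)^[a] c → a ≤ b →
      (step M)^[b] c = (step M)^[a] c := by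
    intro a b ha hab
    obtain ⟨d, rfl⟩ := Nat.exists_eq_add_of_le' hab
    rw [Function.iterate_add_apply, Function.iterate_fixed ha]
  rcases le_total s t with hst | hst
  · exact (h s t hs hst).symm
  · exact h t s ht hst

theorem outputs_iff_of_halts {M : BSSProgram} {v w w' : List ℝ} (h : M.Outputs v w) :
    M.Outputs v w' ↔ w' = w := by
  refine ⟨?_, fun e => e ▸ h⟩
  rintro ⟨s, hs, rfl⟩
  obtain ⟨t, ht, rfl⟩ := h
  rw [iterate_eq_of_fixed (step_eq_self_of_halt hs) (step_eq_self_of_halt ht)]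

theorem not_outputs_of_stuck {M : BSSProgram} {v w : List ℝ}
    (h : Reaches M (init v) fun c => step M c = c ∧ M[c.line]? ≠ some BSSInstr.halt) :
    ¬ M.Outputs v w := by
  rintro ⟨s, hs, -⟩
  obtain ⟨t, ht, hne⟩ := h
  rw [iterate_eq_of_fixed (step_eq_self_of_halt hs) ht] at hs
  exact hne hs

/-- Instructions after which the machine always moves to the next line. -/
def Straight : BSSInstr → Prop
  | .idxBranch _ _ _ => False
  | .branchLT _ => False
  | .halt => False
  | _ => True

theorem exec_line {ins : BSSInstr} (h : Straight ins) (c : BSSConfig) :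
    (exec ins c).line = c.line + 1 := by
  cases ins <;> first | rfl | exact h.elim

/-- The effect of a straight-line block of instructions. -/
noncomputable def run (B : List BSSInstr) (c : BSSConfig) : BSSConfig :=
  B.foldl (fun c ins => exec ins c) c

theorem run_append (B B' : List BSSInstr) (c : BSSConfig) :
    run (B ++ B') c = run B' (run B c) := by
  simp [run]

theorem run_cons (ins : BSSInstr) (B : List BSSInstr) (c : BSSConfig) :
    run (ins :: B) c = run B (exec ins c) := rfl

theorem run_nil (c : BSSConfig) : run [] c = c := rfl

theorem iterate_step_eq_run {M : BSSProgram} {B : List BSSInstr} (hB : ∀ ins ∈ B, Straight ins)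
    (c : BSSConfig) (h : B <+: M.drop c.line) :
    (step M)^[B.length] c = run B c := by
  induction B generalizing c with
  | nil => rfl
  | cons ins B ih =>
    obtain ⟨r, hr⟩ := h
    have h0 : M[c.line]? = some ins := by
      have := congrArg (fun l => l[0]?) hr
      simpa using this.symm
    rw [List.length_cons, Function.iterate_succ_apply, step_eq_exec h0, run_cons]
    refine ih (fun i hi => hB i (List.mem_cons_of_mem _ hi)) _ ?_
    rw [exec_line (hB ins List.mem_cons_self)]
    refine ⟨r, ?_⟩
    have := congrArg List.tail hr
    simpa [List.tail_drop] using this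

/-- `R_d := R_s`, by way of the index registers `I_0` and `I_1`. -/
def copyBlock (d s : ℕ) : List BSSInstr :=
  .idxZero 0 :: (List.replicate d (.idxSucc 0) ++
    (.idxZero 1 :: (List.replicate s (.idxSucc 1) ++ [.copy])))

theorem run_replicate_idxSucc (n i : ℕ) (c : BSSConfig) :
    run (List.replicate n (.idxSucc i)) c =
      ⟨c.line + n, Function.update c.idx i (c.idx i + n), c.reg⟩ := by
  induction n generalizing c with
  | zero => simp [run_nil]
  | succ n ih =>
    rw [List.replicate_succ, run_cons, ih]
    simp only [exec, Function.update_self, Function.update_idem]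
    congr 1
    · omega
    · congr 1
      omega

theorem run_copyBlock (d s : ℕ) (c : BSSConfig) :
    run (copyBlock d s) c =
      ⟨c.line + (d + s + 3), Function.update (Function.update c.idx 0 d) 1 s,
        Function.update c.reg d (c.reg s)⟩ := by
  simp only [copyBlock, run_cons, run_append, run_replicate_idxSucc, run_nil, exec]
  simp only [Function.update_self, Function.update_idem, zero_add, ne_eq, zero_ne_one,
    not_false_eq_true, Function.update_of_ne]
  congr 1
  omega

theorem straight_copyBlock (d s : ℕ) : ∀ ins ∈ copyBlock d s, Straight ins := by
  intro ins h
  simp only [copyBlock, List.mem_cons, List.mem_append, List.mem_replicate,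
    List.not_mem_nil, or_false] at h
  rcases h with rfl | ⟨-, rfl⟩ | rfl | ⟨-, rfl⟩ | rfl <;> trivial

/-- `R_d := R_a + r`; changes the auxiliary registers `R_0, R_1, R_2`. -/
def addConstBlock (d a : ℕ) (r : ℝ) : List BSSInstr :=
  copyBlock 1 a ++ ([.const 2 r, .add] ++ copyBlock d 0)

/-- `R_d := R_a * r`; changes the auxiliary registers `R_0, R_1, R_2`. -/
def mulConstBlock (d a : ℕ) (r : ℝ) : List BSSInstr :=
  copyBlock 1 a ++ ([.const 2 r, .mul] ++ copyBlock d 0)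

/-- Load `R_a` and `R_b` into `R_1` and `R_2`. -/
def loadBlock (a b : ℕ) : List BSSInstr :=
  copyBlock 1 a ++ copyBlock 2 b

@[simp] theorem length_copyBlock (d s : ℕ) : (copyBlock d s).length = d + s + 3 := by
  simp [copyBlock]
  omega

@[simp] theorem length_addConstBlock (d a : ℕ) (r : ℝ) :
    (addConstBlock d a r).length = d + a + 9 := by
  simp [addConstBlock]
  omega

@[simp] theorem length_mulConstBlock (d a : ℕ) (r : ℝ) :
    (mulConstBlock d a r).length = d + a + 9 := by
  simp [mulConstBlock]
  omega

@[simp] theorem length_loadBlock (a b : ℕ) : (loadBlock a b).length = a + b + 9 := by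
  simp [loadBlock]
  omega

theorem straight_append {B B' : List BSSInstr} (h : ∀ ins ∈ B, Straight ins)
    (h' : ∀ ins ∈ B', Straight ins) : ∀ ins ∈ B ++ B', Straight ins := by
  intro ins hi
  rcases List.mem_append.1 hi with hi | hi
  exacts [h _ hi, h' _ hi]

theorem straight_addConstBlock (d a : ℕ) (r : ℝ) : ∀ ins ∈ addConstBlock d a r, Straight ins :=
  straight_append (straight_copyBlock _ _)
    (straight_append (by simp [Straight]) (straight_copyBlock _ _))

theorem straight_mulConstBlock (d a : ℕ) (r : ℝ) : ∀ ins ∈ mulConstBlock d a r, Straight ins :=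
  straight_append (straight_copyBlock _ _)
    (straight_append (by simp [Straight]) (straight_copyBlock _ _))

theorem straight_loadBlock (a b : ℕ) : ∀ ins ∈ loadBlock a b, Straight ins :=
  straight_append (straight_copyBlock _ _) (straight_copyBlock _ _)

/-- Registers 0, 1 and 2 are scratch space for the arithmetic instructions, so persistent data lives
in registers from 3 on and only these are tracked. -/
theorem run_addConstBlock_reg (d a : ℕ) (r : ℝ) (c : BSSConfig) (k : ℕ) (hk : 3 ≤ k) :
    (run (addConstBlock d a r) c).reg k = if k = d then c.reg a + r else c.reg k := by
  have h0 : k ≠ 0 := by omega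
  have h1 : k ≠ 1 := by omega
  have h2 : k ≠ 2 := by omega
  simp only [addConstBlock, run_append, run_copyBlock, run_cons, run_nil, exec]
  by_cases hd : k = d
  · subst hd
    simp
  · simp [hd, h0, h1, h2]

theorem run_mulConstBlock_reg (d a : ℕ) (r : ℝ) (c : BSSConfig) (k : ℕ) (hk : 3 ≤ k) :
    (run (mulConstBlock d a r) c).reg k = if k = d then c.reg a * r else c.reg k := by
  have h0 : k ≠ 0 := by omega
  have h1 : k ≠ 1 := by omega
  have h2 : k ≠ 2 := by omega
  simp only [mulConstBlock, run_append, run_copyBlock, run_cons, run_nil, exec]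
  by_cases hd : k = d
  · subst hd
    simp
  · simp [hd, h0, h1, h2]

theorem run_loadBlock_reg (a b : ℕ) (c : BSSConfig) (k : ℕ) (hk : 3 ≤ k) :
    (run (loadBlock a b) c).reg k = c.reg k := by
  have h1 : k ≠ 1 := by omega
  have h2 : k ≠ 2 := by omega
  simp [loadBlock, run_append, run_copyBlock, h1, h2]

theorem run_line {B : List BSSInstr} (hB : ∀ ins ∈ B, Straight ins) (c : BSSConfig) :
    (run B c).line = c.line + B.length := by
  induction B generalizing c with
  | nil => rfl
  | cons ins B ih =>
    rw [run_cons, ih (fun i hi => hB i (List.mem_cons_of_mem _ hi)),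
      exec_line (hB ins List.mem_cons_self), List.length_cons]
    omega

theorem Reaches.of_run {M : BSSProgram} {B : List BSSInstr} {c : BSSConfig}
    {P : BSSConfig → Prop} (hB : ∀ ins ∈ B, Straight ins) (h : B <+: M.drop c.line)
    (hP : Reaches M (run B c) P) : Reaches M c P :=
  Reaches.trans (P := fun c' => c' = run B c) ⟨B.length, iterate_step_eq_run hB c h⟩
    fun _ e => e ▸ hP

theorem Reaches.of_step {M : BSSProgram} {c : BSSConfig} {P : BSSConfig → Prop}
    (hP : Reaches M (step M c) P) : Reaches M c P :=
  Reaches.trans (P := fun c' => c' = step M c) ⟨1, rfl⟩ fun _ e => e ▸ hP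

/-- Compare `R_a` with `R_b` and branch. -/
theorem Reaches.of_compare {M : BSSProgram} {a b l : ℕ} (hb : b ≠ 1) {c : BSSConfig}
    {P : BSSConfig → Prop} (h : loadBlock a b ++ [.branchLT l] <+: M.drop c.line)
    (hP : ∀ c', (∀ k, 3 ≤ k → c'.reg k = c.reg k) →
      c'.line = (if c.reg a < c.reg b then l else c.line + (a + b + 10)) → Reaches M c' P) :
    Reaches M c P := by
  refine Reaches.of_run (straight_loadBlock a b) ((List.prefix_append _ _).trans h) ?_
  refine Reaches.of_step (hP _ ?_ ?_) <;>
  · have hl := run_line (straight_loadBlock a b) c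
    have hins : M[(run (loadBlock a b) c).line]? = some (.branchLT l) := by
      obtain ⟨r, hr⟩ := h
      have := congrArg (fun L => L[(loadBlock a b).length]?) hr
      rw [hl]
      simpa using this.symm
    rw [step_eq_exec hins]
    first
    | intro k hk
      exact run_loadBlock_reg a b c k hk
    | simp only [exec, hl]
      have h1 : (run (loadBlock a b) c).reg 1 = c.reg a := by
        simp [loadBlock, run_append, run_copyBlock]
      -- `R_1` is overwritten before `R_b` is read; this is where `b ≠ 1` is needed.
      have h2 : (run (loadBlock a b) c).reg 2 = c.reg b := by
        simp [loadBlock, run_append, run_copyBlock, hb]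
      have h3 : (loadBlock a b).length + 1 = a + b + 10 := by
        rw [length_loadBlock]
      rw [h1, h2, add_assoc, h3]

/-- Jump unconditionally. -/
theorem Reaches.of_jump {M : BSSProgram} {i l : ℕ} {c : BSSConfig} {P : BSSConfig → Prop}
    (h : M[c.line]? = some (.idxBranch i i l)) (hP : Reaches M ⟨l, c.idx, c.reg⟩ P) :
    Reaches M c P := by
  refine Reaches.of_step ?_
  rw [step_eq_exec h]
  simpa [exec] using hP

end BSSProgram

/-! ### Binary prefixes, the stopping condition and the oracle constant -/

/-- The integer whose binary expansion is a `1` followed by the first `k` binary digits of `x`. -/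
noncomputable def binaryPrefix (x : ℝ) (k : ℕ) : ℕ := ⌊2 ^ k * (1 + x)⌋₊

/-- The search for a stopping prefix of `x` ends at length `k`: either nothing of the binary
expansion of `x` is left, or the prefix is outside the set `b`. -/
def SearchStops (b : ℕ → Bool) (x : ℝ) (k : ℕ) : Prop :=
  2 ^ k * (1 + x) = binaryPrefix x k ∨ b (binaryPrefix x k) = false

theorem cantorFunction_third_bounds (b : ℕ → Bool) :
    0 ≤ Cardinal.cantorFunction (1 / 3) b ∧ Cardinal.cantorFunction (1 / 3) b ≤ 3 / 2 := by
  have h0 : Cardinal.cantorFunction (1 / 3) (fun _ => false) = 0 := by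
    simp [Cardinal.cantorFunction, Cardinal.cantorFunctionAux]
  have h1 : Cardinal.cantorFunction (1 / 3) (fun _ => true) = 3 / 2 := by
    simp only [Cardinal.cantorFunction, Cardinal.cantorFunctionAux, cond_true]
    rw [tsum_geometric_of_lt_one (by norm_num) (by norm_num)]
    norm_num
  constructor
  · rw [← h0]
    exact Cardinal.cantorFunction_le (by norm_num) (by norm_num) (by simp)
  · rw [← h1]
    exact Cardinal.cantorFunction_le (by norm_num) (by norm_num) (by simp)

/-- The real number whose ternary digits are the values of `b` from `i` on. -/
noncomputable def ternaryShift (b : ℕ → Bool) (i : ℕ) : ℝ :=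
  Cardinal.cantorFunction (1 / 3) fun n => b (n + i)

theorem ternaryShift_eq (b : ℕ → Bool) (i : ℕ) :
    ternaryShift b i = cond (b i) 1 0 + 1 / 3 * ternaryShift b (i + 1) := by
  unfold ternaryShift
  rw [Cardinal.cantorFunction_succ _ (by norm_num) (by norm_num)]
  simp only [zero_add, add_assoc, add_comm 1 i]

/-- The digits after the first contribute at most `1/3 * 3/2 = 1/2`, so comparison with 1 reads off
the leading digit. In base 2 the expansions `0111…` and `1000…` would be indistinguishable. -/
theorem ternaryShift_lt_one_iff (b : ℕ → Bool) (i : ℕ) :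
    ternaryShift b i < 1 ↔ b i = false := by
  have h := cantorFunction_third_bounds fun n => b (n + (i + 1))
  have h' := ternaryShift_eq b i
  rw [ternaryShift] at h'
  cases hb : b i <;> simp only [hb, cond_true, cond_false, ternaryShift] at h' ⊢ <;> simp <;>
    linarith

theorem ternaryShift_succ (b : ℕ → Bool) (i : ℕ) :
    ternaryShift b (i + 1) = (ternaryShift b i - cond (b i) 1 0) * 3 := by
  rw [ternaryShift_eq b i]
  ring

theorem binaryPrefix_le_succ {x : ℝ} (hx : 0 ≤ x) (k : ℕ) :
    binaryPrefix x k ≤ binaryPrefix x (k + 1) := by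
  refine Nat.floor_mono ?_
  rw [pow_succ]
  have : 0 ≤ (2 : ℝ) ^ k * (1 + x) := by positivity
  linarith

/-! ### The search machine and its correctness -/

namespace BSSProgram

/-- The machine searching for a stopping prefix. `R_3` holds `2 ^ k * (1 + x)`, `R_4` a counter `i`
running up to its integer part, `R_5` the ternary digits of the oracle `A` from `i` on, and
`R_6 = 1`. -/
noncomputable def prefixSearch (A : ℝ) : BSSProgram :=
  List.flatten
    -- Instruction 2 jumps to itself: inputs of the wrong length, `x < 0` and `x > 1` are sent
    -- there, so the machine does not halt on them.
    [[.idxSucc 1, .idxBranch 0 1 3, .idxBranch 0 0 2, .branchLT 2],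
    copyBlock 3 1 ++ [.const 6 1], loadBlock 6 3, [.branchLT 2],
    [.const 4 0, .const 5 A] ++ addConstBlock 3 3 1,
    -- line 48
    addConstBlock 7 4 1, loadBlock 3 7, [.branchLT 165],
    addConstBlock 4 4 1, loadBlock 5 6, [.branchLT 145],
    addConstBlock 5 5 (-1),
    -- line 145
    mulConstBlock 5 5 3, [.idxBranch 0 0 48],
    -- line 165
    loadBlock 4 3, [.branchLT 191],
    -- line 182
    copyBlock 0 4 ++ [.idxZero 0], [.halt],
    -- line 191
    loadBlock 5 6, [.branchLT 182],
    mulConstBlock 3 3 2, [.idxBranch 0 0 48]]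

/-- The configuration `c` is in line `l`, with `y`, `i`, `z` and `1` in the main registers. -/
def At (l : ℕ) (y i z : ℝ) (c : BSSConfig) : Prop :=
  c.line = l ∧ c.reg 3 = y ∧ c.reg 4 = i ∧ c.reg 5 = z ∧ c.reg 6 = 1

/-- The configuration `c` is a halting one with output `n`. -/
def HaltsWith (M : BSSProgram) (n : ℝ) (c : BSSConfig) : Prop :=
  M[c.line]? = some BSSInstr.halt ∧ c.idx 0 = 0 ∧ c.reg 0 = n

variable {A : ℝ}

theorem prefixSearch_halt {y i z : ℝ} {c : BSSConfig} (hc : At 182 y i z c) :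
    Reaches (prefixSearch A) c (HaltsWith (prefixSearch A) i) := by
  obtain ⟨hl, -, h4, -, -⟩ := hc
  have hB : ∀ ins ∈ copyBlock 0 4 ++ [.idxZero 0], Straight ins :=
    straight_append (straight_copyBlock _ _) (by simp [Straight])
  refine Reaches.of_run hB
    (by rw [hl]; simp [prefixSearch, List.drop_append, List.drop_of_length_le])
    (Reaches.refl ⟨?_, ?_, ?_⟩)
  · rw [run_line hB, hl]
    simp [prefixSearch]
  · simp [run_append, run_cons, run_nil, exec]
  · simp [run_append, run_cons, run_nil, exec, run_copyBlock, h4]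

theorem prefixSearch_shift {y i z : ℝ} {c : BSSConfig} (hc : At 145 y i z c) :
    Reaches (prefixSearch A) c (At 48 y i (z * 3)) := by
  obtain ⟨hl, h3, h4, h5, h6⟩ := hc
  refine Reaches.of_run (straight_mulConstBlock 5 5 3)
    (by rw [hl]; simp [prefixSearch, List.drop_append, List.drop_of_length_le]) ?_
  refine Reaches.of_jump (i := 0) (l := 48) ?_ (Reaches.refl ⟨rfl, ?_⟩)
  · rw [run_line (straight_mulConstBlock 5 5 3), hl]
    simp [prefixSearch]
  · simp [run_mulConstBlock_reg, h3, h4, h5, h6]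

/-- One round of the inner loop: the counter moves past `i` and the oracle digit `b i` is discarded.
Subtracting 1 is skipped when that digit is 0, and both branches meet at the multiplication by 3. -/
theorem prefixSearch_advance {b : ℕ → Bool} {y : ℝ} {i : ℕ} (hi : (i : ℝ) + 1 ≤ y)
    {c : BSSConfig} (hc : At 48 y i (ternaryShift b i) c) :
    Reaches (prefixSearch A) c (At 48 y (i + 1 : ℕ) (ternaryShift b (i + 1))) := by
  obtain ⟨hl, h3, h4, h5, h6⟩ := hc
  refine Reaches.of_run (straight_addConstBlock 7 4 1)
    (by rw [hl]; simp [prefixSearch, List.drop_append, List.drop_of_length_le]) ?_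
  have hl1 := run_line (straight_addConstBlock 7 4 1) c
  refine Reaches.of_compare (a := 3) (b := 7) (l := 165) (by norm_num)
    (by rw [hl1, hl]; simp [prefixSearch, List.drop_append, List.drop_of_length_le])
      fun c1 hr1 hc1 => ?_
  rw [hl1, hl, run_addConstBlock_reg _ _ _ _ _ (by norm_num),
    run_addConstBlock_reg _ _ _ _ _ (by norm_num), if_neg (show ¬ (3 : ℕ) = 7 by norm_num), if_pos rfl,
    h3, h4,
    if_neg (not_lt.2 hi)] at hc1
  -- The address is 48 plus 20 for the addition block plus 20 for the comparison.
  replace hc1 : c1.line = 88 := hc1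
  have h3' : c1.reg 3 = y := by simp [hr1, run_addConstBlock_reg, h3]
  have h4' : c1.reg 4 = i := by simp [hr1, run_addConstBlock_reg, h4]
  have h5' : c1.reg 5 = ternaryShift b i := by simp [hr1, run_addConstBlock_reg, h5]
  have h6' : c1.reg 6 = 1 := by simp [hr1, run_addConstBlock_reg, h6]
  refine Reaches.of_run (straight_addConstBlock 4 4 1)
    (by rw [hc1]; simp [prefixSearch, List.drop_append, List.drop_of_length_le]) ?_
  have hl2 := run_line (straight_addConstBlock 4 4 1) c1
  refine Reaches.of_compare (a := 5) (b := 6) (l := 145) (by norm_num)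
    (by rw [hl2, hc1]; simp [prefixSearch, List.drop_append, List.drop_of_length_le])
      fun c2 hr2 hc2 => ?_
  rw [hl2, hc1, run_addConstBlock_reg _ _ _ _ _ (by norm_num),
    run_addConstBlock_reg _ _ _ _ _ (by norm_num), if_neg (show ¬ (5 : ℕ) = 4 by norm_num),
    if_neg (show ¬ (6 : ℕ) = 4 by norm_num), h5', h6'] at hc2
  have h3'' : c2.reg 3 = y := by simp [hr2, run_addConstBlock_reg, h3']
  have h4'' : c2.reg 4 = (i + 1 : ℕ) := by simp [hr2, run_addConstBlock_reg, h4']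
  have h5'' : c2.reg 5 = ternaryShift b i := by simp [hr2, run_addConstBlock_reg, h5']
  have h6'' : c2.reg 6 = 1 := by simp [hr2, run_addConstBlock_reg, h6']
  rw [ternaryShift_succ]
  refine Reaches.trans (P := At 145 y (i + 1 : ℕ) (ternaryShift b i - cond (b i) 1 0)) ?_
    fun c' hc' => prefixSearch_shift hc'
  cases hb : b i
  · rw [if_pos ((ternaryShift_lt_one_iff b i).2 hb)] at hc2
    exact Reaches.refl ⟨hc2, h3'', h4'', by simp [h5''], h6''⟩
  · rw [if_neg (by rw [ternaryShift_lt_one_iff, hb]; simp)] at hc2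
    -- The address is 88 plus 17 for the addition block plus 21 for the comparison.
    replace hc2 : c2.line = 126 := hc2
    refine Reaches.of_run (straight_addConstBlock 5 5 (-1))
      (by rw [hc2]; simp [prefixSearch, List.drop_append, List.drop_of_length_le])
      (Reaches.refl ⟨?_, ?_⟩)
    · rw [run_line (straight_addConstBlock 5 5 (-1)), hc2]
      simp
    · simp [run_addConstBlock_reg, h3'', h4'', h5'', h6'', sub_eq_add_neg]

theorem prefixSearch_found {y i z : ℝ} (hi : y < i + 1) {c : BSSConfig} (hc : At 48 y i z c) :
    Reaches (prefixSearch A) c (At 165 y i z) := by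
  obtain ⟨hl, h3, h4, h5, h6⟩ := hc
  refine Reaches.of_run (straight_addConstBlock 7 4 1)
    (by rw [hl]; simp [prefixSearch, List.drop_append, List.drop_of_length_le]) ?_
  have hl1 := run_line (straight_addConstBlock 7 4 1) c
  refine Reaches.of_compare (a := 3) (b := 7) (l := 165) (by norm_num)
    (by rw [hl1, hl]; simp [prefixSearch, List.drop_append, List.drop_of_length_le])
      fun c1 hr1 hc1 => Reaches.refl ?_
  rw [run_addConstBlock_reg _ _ _ _ _ (by norm_num),
    run_addConstBlock_reg _ _ _ _ _ (by norm_num), if_neg (show ¬ (3 : ℕ) = 7 by norm_num), if_pos rfl,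
    h3, h4,
    if_pos hi] at hc1
  refine ⟨hc1, ?_⟩
  simp [hr1, run_addConstBlock_reg, h3, h4, h5, h6]

theorem prefixSearch_stop {y i z : ℝ} (h : y ≤ i ∨ z < 1) {c : BSSConfig} (hc : At 165 y i z c) :
    Reaches (prefixSearch A) c (HaltsWith (prefixSearch A) i) := by
  refine Reaches.trans (P := At 182 y i z) ?_ fun c' hc' => prefixSearch_halt hc'
  obtain ⟨hl, h3, h4, h5, h6⟩ := hc
  refine Reaches.of_compare (a := 4) (b := 3) (l := 191) (by norm_num)
    (by rw [hl]; simp [prefixSearch, List.drop_append, List.drop_of_length_le]) fun c1 hr1 hc1 => ?_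
  rw [h3, h4, hl] at hc1
  have hr : c1.reg 3 = y ∧ c1.reg 4 = i ∧ c1.reg 5 = z ∧ c1.reg 6 = 1 := by
    simp [hr1, h3, h4, h5, h6]
  by_cases hy : i < y
  · rw [if_pos hy] at hc1
    refine Reaches.of_compare (a := 5) (b := 6) (l := 182) (by norm_num)
      (by rw [hc1]; simp [prefixSearch, List.drop_append, List.drop_of_length_le])
        fun c2 hr2 hc2 => Reaches.refl ?_
    rw [hr.2.2.1, hr.2.2.2, if_pos (h.resolve_left (not_le.2 hy))] at hc2
    exact ⟨hc2, by simp [hr2, hr]⟩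
  · rw [if_neg hy] at hc1
    exact Reaches.refl ⟨hc1, hr⟩

theorem prefixSearch_double {y i z : ℝ} (hy : i < y) (hz : 1 ≤ z) {c : BSSConfig}
    (hc : At 165 y i z c) : Reaches (prefixSearch A) c (At 48 (y * 2) i z) := by
  obtain ⟨hl, h3, h4, h5, h6⟩ := hc
  refine Reaches.of_compare (a := 4) (b := 3) (l := 191) (by norm_num)
    (by rw [hl]; simp [prefixSearch, List.drop_append, List.drop_of_length_le]) fun c1 hr1 hc1 => ?_
  rw [h3, h4, if_pos hy] at hc1
  refine Reaches.of_compare (a := 5) (b := 6) (l := 182) (by norm_num)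
    (by rw [hc1]; simp [prefixSearch, List.drop_append, List.drop_of_length_le])
      fun c2 hr2 hc2 => ?_
  rw [hr1 _ (by norm_num), hr1 _ (by norm_num), h5, h6, if_neg (not_lt.2 hz), hc1] at hc2
  refine Reaches.of_run (straight_mulConstBlock 3 3 2)
    (by rw [hc2]; simp [prefixSearch, List.drop_append, List.drop_of_length_le]) ?_
  refine Reaches.of_jump (i := 0) (l := 48) ?_ (Reaches.refl ⟨rfl, ?_⟩)
  · rw [run_line (straight_mulConstBlock 3 3 2), hc2]
    simp [prefixSearch]
  · simp [run_mulConstBlock_reg, hr1, hr2, h3, h4, h5, h6]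

theorem prefixSearch_count {b : ℕ → Bool} {y : ℝ} (hy : 0 ≤ y) (d : ℕ) {i : ℕ}
    (hd : i + d = ⌊y⌋₊) {c : BSSConfig} (hc : At 48 y i (ternaryShift b i) c) :
    Reaches (prefixSearch A) c (At 165 y ⌊y⌋₊ (ternaryShift b ⌊y⌋₊)) := by
  induction d generalizing i c with
  | zero =>
    rw [add_zero] at hd
    subst hd
    exact prefixSearch_found (Nat.lt_floor_add_one y) hc
  | succ d ih =>
    have hi : ((i + 1 : ℕ) : ℝ) ≤ y := (Nat.le_floor_iff hy).1 (by omega)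
    exact (prefixSearch_advance (by exact_mod_cast hi) hc).trans fun c' hc' =>
      ih (by omega) hc'

/-- Induction on the number of doublings left. The counter need not be reset after a doubling:
prefixes grow with their length, so oracle digits already discarded are never consulted again. The
hypothesis `hi` keeps track of this. -/
theorem prefixSearch_loop {b : ℕ → Bool} {x : ℝ} (hx : 0 ≤ x) {K : ℕ} (hK : SearchStops b x K)
    (hmin : ∀ k < K, ¬ SearchStops b x k) (d : ℕ) {k : ℕ} (hd : k + d = K) {i : ℕ}
    (hi : i ≤ binaryPrefix x k) {c : BSSConfig}
    (hc : At 48 (2 ^ k * (1 + x)) i (ternaryShift b i) c) :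
    Reaches (prefixSearch A) c (HaltsWith (prefixSearch A) (binaryPrefix x K)) := by
  have hpos : ∀ k : ℕ, 0 ≤ (2 : ℝ) ^ k * (1 + x) := fun k => by positivity
  induction d generalizing k i c with
  | zero =>
    rw [add_zero] at hd
    subst hd
    refine (prefixSearch_count (hpos k) _ (Nat.add_sub_of_le hi) hc).trans fun c' hc' =>
      prefixSearch_stop ?_ hc'
    exact hK.imp le_of_eq (ternaryShift_lt_one_iff b _).2
  | succ d ih =>
    have hk := hmin k (by omega)
    rw [SearchStops, not_or] at hk
    refine (prefixSearch_count (hpos k) _ (Nat.add_sub_of_le hi) hc).trans fun c' hc' =>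
      (prefixSearch_double ?_ ?_ hc').trans fun c'' hc'' => ?_
    · exact lt_of_le_of_ne (Nat.floor_le (hpos k)) (Ne.symm hk.1)
    · exact not_lt.1 fun h => hk.2 ((ternaryShift_lt_one_iff b _).1 h)
    · refine ih (k := k + 1) (by omega) (binaryPrefix_le_succ hx k) ?_
      rwa [pow_succ, mul_right_comm]

theorem prefixSearch_single (x : ℝ) :
    Reaches (prefixSearch A) (init [x])
      fun c => c.line = 3 ∧ c.reg 1 = x ∧ c.reg 2 = 0 := by
  have h0 : (prefixSearch A)[(init [x]).line]? = some (.idxSucc 1) := by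
    simp [prefixSearch, init]
  refine Reaches.of_step (Reaches.of_step (Reaches.refl ?_))
  rw [step_eq_exec h0, step_eq_exec (ins := .idxBranch 0 1 3) (by simp [prefixSearch, exec, init])]
  simp [exec, init]

theorem prefixSearch_wrong_length {v : List ℝ} (hv : v.length ≠ 1) :
    Reaches (prefixSearch A) (init v) fun c => c.line = 2 := by
  have h0 : (prefixSearch A)[(init v).line]? = some (.idxSucc 1) := by
    simp [prefixSearch, init]
  refine Reaches.of_step (Reaches.of_step (Reaches.refl ?_))
  rw [step_eq_exec h0, step_eq_exec (ins := .idxBranch 0 1 3) (by simp [prefixSearch, exec, init])]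
  simp [exec, init, hv]

theorem step_branchLT {l l' : ℕ} {c : BSSConfig}
    (h : (prefixSearch A)[c.line]? = some (.branchLT l)) (hl : c.line = l') :
    step (prefixSearch A) c = ⟨if c.reg 1 < c.reg 2 then l else l' + 1, c.idx, c.reg⟩ := by
  rw [step_eq_exec h, ← hl]
  rfl

/-- Both outcomes of the comparison with 1 are kept, since accepted inputs and inputs above 1 share
the code up to this point. -/
theorem prefixSearch_compare_one {x : ℝ} (hx : 0 ≤ x) {P : BSSConfig → Prop}
    (hP : ∀ c, c.reg 3 = x → c.reg 6 = 1 → c.line = (if 1 < x then 2 else 31) →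
      Reaches (prefixSearch A) c P) :
    Reaches (prefixSearch A) (init [x]) P := by
  refine (prefixSearch_single x).trans fun c ⟨hl, h1, h2⟩ => Reaches.of_step ?_
  rw [step_branchLT (l := 2) (by rw [hl]; simp [prefixSearch]) hl, h1, h2, if_neg (not_lt.2 hx)]
  have hB : ∀ ins ∈ copyBlock 3 1 ++ [.const 6 1], Straight ins :=
    straight_append (straight_copyBlock _ _) (by simp [Straight])
  refine Reaches.of_run hB (by simp [prefixSearch, List.drop_append]) ?_
  refine Reaches.of_compare (a := 6) (b := 3) (l := 2) (by norm_num) ?_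
    fun c' hr hc' => hP c' ?_ ?_ ?_
  · rw [run_line hB]
    simp [prefixSearch, List.drop_append, List.drop_of_length_le]
  · rw [hr _ (by norm_num)]
    simp [run_append, run_copyBlock, run_cons, run_nil, exec, h1]
  · rw [hr _ (by norm_num)]
    simp [run_append, run_cons, run_nil, exec]
  · rw [hc', run_line hB]
    simp [run_append, run_copyBlock, run_cons, run_nil, exec, h1]

theorem prefixSearch_start {x : ℝ} (hx : x ∈ Set.Icc (0 : ℝ) 1) :
    Reaches (prefixSearch A) (init [x]) (At 48 (1 + x) 0 A) := by
  refine prefixSearch_compare_one hx.1 fun c h3 h6 hl => ?_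
  rw [if_neg (not_lt.2 hx.2)] at hl
  have hB : ∀ ins ∈ [.const 4 0, .const 5 A] ++ addConstBlock 3 3 1, Straight ins :=
    straight_append (by simp [Straight]) (straight_addConstBlock _ _ _)
  refine Reaches.of_run hB
    (by rw [hl]; simp [prefixSearch, List.drop_append, List.drop_of_length_le])
    (Reaches.refl ⟨?_, ?_⟩)
  · rw [run_line hB, hl]
    simp
  · simp [run_addConstBlock_reg, run_cons, exec, h3, h6, add_comm]

theorem prefixSearch_stuck {v : List ℝ} (hv : ∀ x ∈ Set.Icc (0 : ℝ) 1, v ≠ [x]) :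
    Reaches (prefixSearch A) (init v) fun c => c.line = 2 := by
  by_cases hlen : v.length = 1
  · obtain ⟨x, rfl⟩ := List.length_eq_one_iff.1 hlen
    by_cases hx : 0 ≤ x
    · refine prefixSearch_compare_one hx fun c _ _ hl => Reaches.refl ?_
      rwa [if_pos (not_le.1 fun h => hv x ⟨hx, h⟩ rfl)] at hl
    · refine (prefixSearch_single x).trans fun c ⟨hl, h1, h2⟩ => Reaches.of_step (Reaches.refl ?_)
      rw [step_branchLT (l := 2) (by rw [hl]; simp [prefixSearch]) hl, h1, h2,
        if_pos (not_le.1 hx)]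
  · exact prefixSearch_wrong_length hlen

theorem not_outputs_prefixSearch {v w : List ℝ} (hv : ∀ x ∈ Set.Icc (0 : ℝ) 1, v ≠ [x]) :
    ¬ (prefixSearch A).Outputs v w := by
  refine not_outputs_of_stuck ((prefixSearch_stuck hv).trans fun c hl => Reaches.refl ?_)
  have h : (prefixSearch A)[c.line]? = some (.idxBranch 0 0 2) := by
    rw [hl]
    simp [prefixSearch]
  refine ⟨?_, by simp [h]⟩
  rw [step_eq_exec h]
  cases c
  simp_all [exec]

theorem outputs_prefixSearch {b : ℕ → Bool} {x : ℝ} (hx : x ∈ Set.Icc (0 : ℝ) 1) {k : ℕ}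
    (hk : SearchStops b x k) (hmin : ∀ j < k, ¬ SearchStops b x j) :
    (prefixSearch (ternaryShift b 0)).Outputs [x] [(binaryPrefix x k : ℝ)] := by
  obtain ⟨t, h1, h2, h3⟩ := (prefixSearch_start (A := ternaryShift b 0) hx).trans fun c hc =>
    prefixSearch_loop hx.1 hk hmin k (k := 0) (zero_add k) (i := 0) (Nat.zero_le _) (c := c)
      (by simpa using hc)
  exact ⟨t, h1, by simp [h2, h3]⟩

end BSSProgram

/-- A function that returns the shortest stopping prefix of `x` is BSS-computable. -/
theorem bssComputable_of_searchStops (b : ℕ → Bool) (f : Set.Icc (0 : ℝ) 1 → ℕ)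
    (hf : ∀ x : Set.Icc (0 : ℝ) 1, ∃ k, SearchStops b x k ∧ (∀ j < k, ¬ SearchStops b x j) ∧
      f x = binaryPrefix x k) : BSSComputable f := by
  refine ⟨BSSProgram.prefixSearch (ternaryShift b 0), fun v w => ?_⟩
  by_cases hv : ∃ x : Set.Icc (0 : ℝ) 1, v = [(x : ℝ)]
  · obtain ⟨x, rfl⟩ := hv
    obtain ⟨k, hk, hmin, hfx⟩ := hf x
    rw [BSSProgram.outputs_iff_of_halts (BSSProgram.outputs_prefixSearch x.2 hk hmin), ← hfx]
    constructor
    · rintro rfl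
      exact ⟨x, rfl, rfl⟩
    · rintro ⟨x', hx', rfl⟩
      rw [List.singleton_inj] at hx'
      rw [Subtype.ext hx']
  · refine iff_of_false (BSSProgram.not_outputs_prefixSearch fun x hx h => hv ⟨⟨x, hx⟩, h⟩) ?_
    rintro ⟨x, rfl, -⟩
    exact hv ⟨x, rfl⟩

/-! ### Well-founded sets of prefixes -/

/-- The set of binary prefixes all of whose positions with digit `1` have strictly decreasing
labels. -/
def DecreasingPrefix (L : ℕ → Ordinal.{0}) (n : ℕ) : Prop :=
  ∀ i j, i < j → Odd (n / 2 ^ i) → Odd (n / 2 ^ j) →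
    L (Nat.log 2 (n / 2 ^ i)) < L (Nat.log 2 (n / 2 ^ j))

theorem binaryPrefix_div {x : ℝ} {j k : ℕ} (h : j ≤ k) :
    binaryPrefix x k / 2 ^ (k - j) = binaryPrefix x j := by
  unfold binaryPrefix
  rw [← Nat.floor_div_natCast]
  congr 1
  obtain ⟨d, rfl⟩ := Nat.exists_eq_add_of_le h
  rw [Nat.add_sub_cancel_left, pow_add]
  push_cast
  field_simp

theorem log_binaryPrefix {x : ℝ} (h0 : 0 ≤ x) (h1 : x < 1) (k : ℕ) :
    Nat.log 2 (binaryPrefix x k) = k := by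
  have hpos : (0 : ℝ) < 2 ^ k := by positivity
  refine Nat.log_eq_of_pow_le_of_lt_pow ?_ ?_
  · refine Nat.le_floor ?_
    push_cast
    nlinarith
  · refine (Nat.floor_lt (by positivity)).2 ?_
    push_cast
    rw [pow_succ]
    nlinarith

/-- Quotients of a prefix by powers of 2 are the shorter prefixes, and for `x < 1` the binary
logarithm recovers their lengths. The order of positions is reversed, because a higher power of 2
leaves a shorter prefix. -/
theorem decreasingPrefix_binaryPrefix {L : ℕ → Ordinal.{0}} {x : ℝ} (h0 : 0 ≤ x) (h1 : x < 1)
    {k : ℕ} : DecreasingPrefix L (binaryPrefix x k) ↔ ∀ p q, p < q → q ≤ k →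
      Odd (binaryPrefix x p) → Odd (binaryPrefix x q) → L q < L p := by
  constructor
  · intro h p q hpq hqk hp hq
    have := h (k - q) (k - p) (by omega)
    rw [binaryPrefix_div hqk, binaryPrefix_div (hpq.le.trans hqk), log_binaryPrefix h0 h1,
      log_binaryPrefix h0 h1] at this
    exact this hq hp
  · intro h i j hij hi hj
    -- Beyond the length of the prefix the quotient is 0, which is not odd.
    have hjk : j ≤ k := by
      by_contra hjk
      have hlt : binaryPrefix x k < 2 ^ j :=
        (Nat.lt_pow_of_log_lt one_lt_two (by rw [log_binaryPrefix h0 h1]; omega))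
      rw [Nat.div_eq_of_lt hlt] at hj
      exact absurd hj (by decide)
    have hp := binaryPrefix_div (x := x) (Nat.sub_le k j)
    have hq := binaryPrefix_div (x := x) (Nat.sub_le k i)
    rw [Nat.sub_sub_self hjk] at hp
    rw [Nat.sub_sub_self (hij.le.trans hjk)] at hq
    rw [hp] at hj ⊢
    rw [hq] at hi ⊢
    rw [log_binaryPrefix h0 h1, log_binaryPrefix h0 h1]
    exact h _ _ (by omega) (by omega) hj hi

/-- If all digits after position `k` were 0, then `2 ^ k * (1 + x)` would exceed its integer part by
less than `2 ^ (-d)` for every `d`, so it would be an integer. -/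
theorem exists_odd_binaryPrefix {x : ℝ} (h0 : 0 ≤ x)
    (h : ∀ k, 2 ^ k * (1 + x) ≠ (binaryPrefix x k : ℝ)) (k : ℕ) :
    ∃ j, k < j ∧ Odd (binaryPrefix x j) := by
  by_contra! hev
  have hd : ∀ d, binaryPrefix x (k + d) = 2 ^ d * binaryPrefix x k := by
    intro d
    induction d with
    | zero => simp
    | succ d ih =>
      have h1 := binaryPrefix_div (x := x) (show k + d ≤ k + (d + 1) by omega)
      have h2 := hev (k + (d + 1)) (by omega)
      rw [Nat.not_odd_iff_even] at h2
      rw [show k + (d + 1) - (k + d) = 1 by omega, pow_one, ih] at h1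
      rw [← Nat.two_mul_div_two_of_even h2, h1]
      ring
  have hle : (binaryPrefix x k : ℝ) ≤ 2 ^ k * (1 + x) := Nat.floor_le (by positivity)
  have hpos : 0 < 2 ^ k * (1 + x) - binaryPrefix x k :=
    sub_pos.2 (lt_of_le_of_ne hle (Ne.symm (h k)))
  obtain ⟨d, hd'⟩ := exists_pow_lt_of_lt_one hpos (show (1 / 2 : ℝ) < 1 by norm_num)
  have hlt : 2 ^ (k + d) * (1 + x) < binaryPrefix x (k + d) + 1 := Nat.lt_floor_add_one _
  rw [hd, pow_add] at hlt
  push_cast at hlt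
  rw [one_div, inv_pow, inv_lt_iff_one_lt_mul₀ (by positivity)] at hd'
  nlinarith

/-- A search that never stops gives a non-dyadic `x`, hence infinitely many digits 1, and their
labels would descend forever. -/
theorem exists_searchStops {L : ℕ → Ordinal.{0}} {b : ℕ → Bool}
    (hb : ∀ n, b n = true → DecreasingPrefix L n) {x : ℝ} (hx : x ∈ Set.Icc (0 : ℝ) 1) :
    ∃ k, SearchStops b x k := by
  by_contra! h
  have h1 : ∀ k, 2 ^ k * (1 + x) ≠ (binaryPrefix x k : ℝ) := fun k hk => h k (Or.inl hk)
  have h2 : ∀ k, DecreasingPrefix L (binaryPrefix x k) := fun k => hb _ <| by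
    by_contra hk
    exact h k (Or.inr (by simpa using hk))
  -- At `x = 1` the search stops at length 0, since `1 + x = 2` is an integer.
  have hx1 : x < 1 := by
    refine lt_of_le_of_ne hx.2 fun e => h1 0 ?_
    rw [binaryPrefix, e]
    norm_num
  obtain ⟨j, -, hj⟩ := exists_odd_binaryPrefix hx.1 h1 0
  -- A digit 1 of least label is followed by another digit 1, whose label is smaller.
  obtain ⟨p, hp, hmin⟩ := (InvImage.wf L wellFounded_lt).has_min
    {p | Odd (binaryPrefix x p)} ⟨j, hj⟩
  obtain ⟨q, hpq, hq⟩ := exists_odd_binaryPrefix hx.1 h1 p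
  exact hmin q hq ((decreasingPrefix_binaryPrefix hx.1 hx1).1 (h2 q) p q hpq le_rfl hp hq)

/-! ### Finite binary expansions -/

/-- The dyadic number `∑ 2^{-c}` over the positions `c ∈ F`. -/
def dyadic (F : Finset ℕ) : ℚ := ∑ c ∈ F, (2⁻¹ : ℚ) ^ c

theorem dyadic_lt {F : Finset ℕ} {p : ℕ} (h : ∀ c ∈ F, p < c) : dyadic F < 2⁻¹ ^ p := by
  have key : ∀ d, ∑ c ∈ Finset.Ioc p (p + d), (2⁻¹ : ℚ) ^ c = 2⁻¹ ^ p - 2⁻¹ ^ (p + d) := by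
    intro d
    induction d with
    | zero => simp
    | succ d ih =>
      rw [← add_assoc, Finset.sum_Ioc_succ_top (by omega), ih, pow_succ]
      ring
  have hsub : F ⊆ Finset.Ioc p (p + F.sup id) := fun c hc => by
    have : c ≤ F.sup id := Finset.le_sup (f := id) hc
    exact Finset.mem_Ioc.2 ⟨h c hc, by omega⟩
  calc dyadic F ≤ ∑ c ∈ Finset.Ioc p (p + F.sup id), (2⁻¹ : ℚ) ^ c :=
        Finset.sum_le_sum_of_subset_of_nonneg hsub fun _ _ _ => by positivity
    _ < 2⁻¹ ^ p := by
        rw [key]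
        exact sub_lt_self _ (by positivity)

theorem dyadic_nonneg (F : Finset ℕ) : 0 ≤ dyadic F :=
  Finset.sum_nonneg fun _ _ => by positivity

theorem dyadic_sub_of_subset {F F' : Finset ℕ} (h : F ⊆ F') :
    dyadic F' - dyadic F = dyadic (F' \ F) := by
  rw [sub_eq_iff_eq_add]
  exact (Finset.sum_sdiff h).symm

/-- The first `p` binary digits after the leading one, as an integer. -/
def truncation (F : Finset ℕ) (p : ℕ) : ℕ := ∑ c ∈ F with c ≤ p, 2 ^ (p - c)

theorem pow_mul_dyadic (F : Finset ℕ) (p : ℕ) :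
    2 ^ p * dyadic F = truncation F p + 2 ^ p * dyadic {c ∈ F | p < c} := by
  rw [dyadic, ← Finset.sum_filter_add_sum_filter_not F (· ≤ p), mul_add]
  simp only [not_le]
  congr 1
  rw [truncation, Nat.cast_sum, Finset.mul_sum]
  refine Finset.sum_congr rfl fun c hc => ?_
  obtain ⟨d, rfl⟩ := Nat.exists_eq_add_of_le (Finset.mem_filter.1 hc).2
  rw [Nat.add_sub_cancel_left, pow_add, inv_pow]
  push_cast
  field_simp

theorem mem_of_odd_truncation {F : Finset ℕ} {p : ℕ} (h : Odd (truncation F p)) : p ∈ F := by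
  by_contra hp
  refine Nat.not_even_iff_odd.2 h (Finset.even_sum _ fun c hc => ?_)
  rw [Finset.mem_filter] at hc
  have : c ≠ p := fun e => hp (e ▸ hc.1)
  exact (Nat.even_pow' (by omega)).2 even_two

theorem pow_mul_one_add_dyadic (F : Finset ℕ) (p : ℕ) :
    (2 : ℝ) ^ p * (1 + ((dyadic F - 1 : ℚ) : ℝ)) =
      truncation F p + ((2 ^ p * dyadic {c ∈ F | p < c} : ℚ) : ℝ) := by
  have h := congrArg (fun q : ℚ => (q : ℝ)) (pow_mul_dyadic F p)
  push_cast at h ⊢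
  rw [← h]
  ring

/-- The positions of `F` up to `p` give an integer and the later ones a fractional part. The latter
is strictly below 1 because `F` is finite, so the expansion cannot end in all ones. -/
theorem binaryPrefix_dyadic (F : Finset ℕ) (p : ℕ) :
    binaryPrefix ((dyadic F - 1 : ℚ) : ℝ) p = truncation F p := by
  have h1 := dyadic_lt (F := {c ∈ F | p < c}) (p := p) fun c hc => (Finset.mem_filter.1 hc).2
  have h2 := dyadic_nonneg {c ∈ F | p < c}
  have hpos : (0 : ℚ) < 2 ^ p := by positivity
  have h3 : 2 ^ p * dyadic {c ∈ F | p < c} < 2 ^ p * 2⁻¹ ^ p := mul_lt_mul_of_pos_left h1 hpos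
  rw [← mul_pow, mul_inv_cancel₀ two_ne_zero, one_pow] at h3
  have h3' : ((2 ^ p * dyadic {c ∈ F | p < c} : ℚ) : ℝ) < 1 := by exact_mod_cast h3
  have h4 : (0 : ℝ) ≤ ((2 ^ p * dyadic {c ∈ F | p < c} : ℚ) : ℝ) := by
    exact_mod_cast mul_nonneg hpos.le h2
  rw [binaryPrefix, pow_mul_one_add_dyadic, Nat.floor_eq_iff (by positivity)]
  constructor <;> linarith

theorem dyadic_sub_one_mem {F : Finset ℕ} (h : 0 ∈ F) :
    0 ≤ ((dyadic F - 1 : ℚ) : ℝ) ∧ ((dyadic F - 1 : ℚ) : ℝ) < 1 := by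
  have h1 : dyadic F - 1 = dyadic (F \ {0}) := by
    rw [← dyadic_sub_of_subset (Finset.singleton_subset_iff.2 h)]
    simp [dyadic]
  have h2 : dyadic (F \ {0}) < 2⁻¹ ^ 0 := dyadic_lt fun c hc => by
    have := (Finset.mem_sdiff.1 hc).2
    rw [Finset.mem_singleton] at this
    omega
  rw [pow_zero] at h2
  rw [h1]
  exact ⟨by exact_mod_cast dyadic_nonneg _, by exact_mod_cast h2⟩

/-- On a dyadic number whose digits have decreasing labels, the search for a stopping prefix ends
with the last digit. -/
theorem searchStops_dyadic {L : ℕ → Ordinal.{0}} {b : ℕ → Bool}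
    (hb : ∀ n, DecreasingPrefix L n → b n = true) {F : Finset ℕ} (h0 : 0 ∈ F)
    (hL : ∀ c ∈ F, ∀ c' ∈ F, c < c' → L c' < L c) {C : ℕ} (hC : C ∈ F) (hmax : ∀ c ∈ F, c ≤ C)
    (k : ℕ) : (k < C → ¬ SearchStops b ((dyadic F - 1 : ℚ) : ℝ) k) ∧
      SearchStops b ((dyadic F - 1 : ℚ) : ℝ) C := by
  obtain ⟨hx0, hx1⟩ := dyadic_sub_one_mem h0
  constructor
  · rintro hk (h | h)
    -- Before `C` the digit at `C` is still to come, so the fractional part is positive.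
    · rw [pow_mul_one_add_dyadic, binaryPrefix_dyadic, add_eq_left] at h
      have hpos : 0 < dyadic {c ∈ F | k < c} :=
        Finset.sum_pos (fun _ _ => by positivity) ⟨C, Finset.mem_filter.2 ⟨hC, hk⟩⟩
      have : (0 : ℝ) < ((2 ^ k * dyadic {c ∈ F | k < c} : ℚ) : ℝ) := by
        exact_mod_cast mul_pos (by positivity) hpos
      exact this.ne' h
    -- Digits 1 of the number occur only at positions in `F`, where labels decrease, so no prefix
    -- leaves the set.
    · refine Bool.false_ne_true (h.symm.trans (hb _ ?_))
      refine (decreasingPrefix_binaryPrefix hx0 hx1).2 fun p q hpq _ hp hq => ?_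
      rw [binaryPrefix_dyadic] at hp hq
      exact hL _ (mem_of_odd_truncation hp) _ (mem_of_odd_truncation hq) hpq
  · left
    have : {c ∈ F | C < c} = (∅ : Finset ℕ) :=
      Finset.filter_eq_empty_iff.2 fun c hc => not_lt.2 (hmax c hc)
    rw [pow_mul_one_add_dyadic, binaryPrefix_dyadic, this]
    simp [dyadic]

open Filter Topology

/-! ### Continuity of functions with finite dependencies -/

theorem continuousOn_of_finite_dependence {A B : Type} [TopologicalSpace A] [DiscreteTopology A]
    [TopologicalSpace B] {F : (ℕ → A) → ℕ → B} {S : Set (ℕ → A)}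
    (h : ∀ p ∈ S, ∀ m, ∃ k, ∀ q : ℕ → A, (∀ j ≤ k, q j = p j) → F q m = F p m) :
    ContinuousOn F S := by
  intro p hp
  refine (continuousAt_pi.2 fun m => ?_).continuousWithinAt
  obtain ⟨k, hk⟩ := h p hp m
  have hev : ∀ᶠ q in 𝓝 p, ∀ j ∈ Finset.range (k + 1), q j = p j :=
    (Finset.eventually_all _).2 fun j _ =>
      ((continuous_apply j : Continuous fun q : ℕ → A => q j).continuousAt (x := p)).eventually_mem
        (mem_nhds_discrete.2 rfl : {p j} ∈ 𝓝 (p j))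
  refine continuousAt_const.congr (f := fun _ => F p m) ?_
  filter_upwards [hev] with q hq
  exact (hk q fun j hj => hq j (Finset.mem_range.2 (by omega))).symm

theorem continuous_blocks : Continuous Cantor.blocks := by
  rw [← continuousOn_univ]
  refine continuousOn_of_finite_dependence fun x _ m => ⟨m, fun y hy => ?_⟩
  simp only [Cantor.blocks, decide_eq_decide]
  refine exists_congr fun k => ?_
  rcases le_or_gt k m with hk | hk
  · rw [Finset.sum_congr rfl fun j hj => hy j (by rw [Finset.mem_range] at hj; omega)]
  · exact iff_of_false (by omega) (by omega)

/-- The restriction of a function on Cantor space to `S`, as a partial function. -/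
def partialOn (F : Cantor → Cantor) (S : Set Cantor) : Cantor →. Cantor :=
  fun p => ⟨p ∈ S, fun _ => F p⟩

theorem mem_partialOn {F : Cantor → Cantor} {S : Set Cantor} {p : Cantor} (hp : p ∈ S) :
    F p ∈ partialOn F S p := ⟨hp, rfl⟩

theorem partialContinuous_partialOn {F : Cantor → Cantor} {S : Set Cantor}
    (h : ContinuousOn F S) : PartialContinuous (partialOn F S) :=
  continuousOn_iff_continuous_domRestrict.1 h

namespace Cantor

/-- The position of the first `1`. -/
noncomputable def firstOne (q : Cantor) : ℕ := sInf {k | q k = true}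

theorem firstOne_decide_le (n : ℕ) : firstOne (fun i => decide (n ≤ i)) = n := by
  simp only [firstOne, decide_eq_true_eq]
  exact (isLeast_Ici (a := n)).csInf_eq

theorem firstOne_congr {q q' : Cantor} {k : ℕ} (hk : q k = true) (h : ∀ j ≤ k, q' j = q j) :
    firstOne q' = firstOne q := by
  have h1 : firstOne q ≤ k := Nat.sInf_le hk
  have hk' : q' k = true := (h k le_rfl).trans hk
  have h2 : firstOne q' ≤ k := Nat.sInf_le hk'
  have h3 : q (firstOne q) = true := Nat.sInf_mem (s := {k | q k = true}) ⟨k, hk⟩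
  have h4 : q' (firstOne q') = true := Nat.sInf_mem (s := {k | q' k = true}) ⟨k, hk'⟩
  exact le_antisymm (Nat.sInf_le ((h _ h1).trans h3)) (Nat.sInf_le ((h _ h2).symm.trans h4))

/-- The sequence of natural numbers named by the left halves of the components of `p`. -/
noncomputable def decodeFst (p : Cantor) : ℕ → ℕ := fun i => firstOne (p.proj i).left

theorem continuousOn_decodeFst :
    ContinuousOn decodeFst {p | ∀ i, ∃ k, (p.proj i).left k = true} := by
  refine continuousOn_of_finite_dependence fun p hp i => ?_
  obtain ⟨k, hk⟩ := hp i
  -- Left halves sit at even positions, and `Nat.pair i` is monotone, so this bound covers all bits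
  -- up to the `k`-th of component `i`.
  refine ⟨Nat.pair i (2 * k), fun q hq => firstOne_congr hk fun j hj => hq _ ?_⟩
  exact (StrictMono.le_iff_le (f := Nat.pair i) fun _ _ h => Nat.pair_lt_pair_right i h).2
    (by omega)

/-- Select the component of `r.left` given by the number named by `r.right`, and return its right
half. -/
noncomputable def selectSnd (stage : ℕ → ℕ) (r : Cantor) : Cantor :=
  (r.left.proj (stage (firstOne r.right))).right

theorem continuousOn_selectSnd (stage : ℕ → ℕ) :
    ContinuousOn (selectSnd stage) {r | ∃ k, r.right k = true} := by
  refine continuousOn_of_finite_dependence fun r hr m => ?_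
  obtain ⟨k, hk⟩ := hr
  -- The first entry bounds the bits that determine the selected component, the second is the single
  -- bit of it that is returned.
  refine ⟨max (2 * k + 1) (2 * Nat.pair (stage (firstOne (right r))) (2 * m + 1)), fun q hq => ?_⟩
  have h : firstOne (right q) = firstOne (right r) :=
    firstOne_congr hk fun j hj => hq _ (le_max_of_le_left (by omega))
  simp only [selectSnd, h]
  exact hq _ (le_max_right _ _)

end Cantor

/-! ### Coding the mind changes of a sequence -/

/-- The position of the binary digit that marks a mind change at stage `i`. It codes `i` and
`a i`. -/
def markPos (a : ℕ → ℕ) : ℕ → ℕ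
  | 0 => Nat.pair 0 (Nat.pair 0 (a 0)) + 1
  | i + 1 => Nat.pair (markPos a i) (Nat.pair (i + 1) (a (i + 1))) + 1

def posStage (c : ℕ) : ℕ := (c - 1).unpair.2.unpair.1

def posCode (c : ℕ) : ℕ := (c - 1).unpair.2.unpair.2

theorem posStage_markPos (a : ℕ → ℕ) (i : ℕ) : posStage (markPos a i) = i := by
  cases i <;> simp [posStage, markPos]

theorem posCode_markPos (a : ℕ → ℕ) (i : ℕ) : posCode (markPos a i) = a i := by
  cases i <;> simp [posCode, markPos]

/-- The previous position is a component of the next one, which forces growth. The added 1 makes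
this strict and keeps position 0 free for the leading digit. -/
theorem strictMono_markPos (a : ℕ → ℕ) : StrictMono (markPos a) :=
  strictMono_nat_of_lt_succ fun _ => Nat.lt_succ_of_le (Nat.left_le_pair _ _)

theorem markPos_congr {a a' : ℕ → ℕ} {i : ℕ} (h : ∀ j ≤ i, a' j = a j) :
    markPos a' i = markPos a i := by
  induction i with
  | zero => simp [markPos, h 0]
  | succ i ih => rw [markPos, markPos, ih fun j hj => h j (by omega), h _ le_rfl]

/-- The set of positions of the mind changes of `u` up to stage `i`, with the position `0`. -/
def marks (r u : ℕ → ℕ) : ℕ → Finset ℕ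
  | 0 => {0, markPos (r ∘ u) 0}
  | i + 1 => if u (i + 1) = u i then marks r u i else insert (markPos (r ∘ u) (i + 1)) (marks r u i)

theorem marks_congr {r u u' : ℕ → ℕ} {i : ℕ} (h : ∀ j ≤ i, u' j = u j) :
    marks r u' i = marks r u i := by
  induction i with
  | zero => simp [marks, markPos, h 0]
  | succ i ih =>
    have hm : markPos (r ∘ u') (i + 1) = markPos (r ∘ u) (i + 1) :=
      markPos_congr fun j hj => by simp [h j hj]
    rw [marks, marks, ih fun j hj => h j (by omega), h _ le_rfl, h i (by omega), hm]

theorem zero_mem_marks (r u : ℕ → ℕ) (i : ℕ) : 0 ∈ marks r u i := by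
  induction i with
  | zero => simp [marks]
  | succ i ih =>
    rw [marks]
    split_ifs
    exacts [ih, Finset.mem_insert_of_mem ih]

theorem le_markPos_of_mem_marks {r u : ℕ → ℕ} {i c : ℕ} (hc : c ∈ marks r u i) :
    c ≤ markPos (r ∘ u) i := by
  induction i with
  | zero =>
    rw [marks, Finset.mem_insert, Finset.mem_singleton] at hc
    omega
  | succ i ih =>
    have hlt := strictMono_markPos (r ∘ u) (Nat.lt_succ_self i)
    rw [marks] at hc
    split_ifs at hc
    · exact (ih hc).trans hlt.le
    · rcases Finset.mem_insert.1 hc with rfl | hc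
      exacts [le_rfl, (ih hc).trans hlt.le]

theorem marks_extend (r u : ℕ → ℕ) (i d : ℕ) : marks r u i ⊆ marks r u (i + d) ∧
    ∀ c ∈ marks r u (i + d) \ marks r u i, markPos (r ∘ u) i < c := by
  induction d with
  | zero => simp
  | succ d ih =>
    rw [← add_assoc, marks]
    split_ifs
    · exact ih
    · refine ⟨ih.1.trans (Finset.subset_insert _ _), fun c hc => ?_⟩
      rw [Finset.mem_sdiff, Finset.mem_insert] at hc
      rcases hc with ⟨rfl | hc, hc'⟩
      · exact strictMono_markPos _ (by omega)
      · exact ih.2 c (Finset.mem_sdiff.2 ⟨hc, hc'⟩)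

theorem marks_eq_of_const {r u : ℕ → ℕ} {N : ℕ} (h : ∀ i, N ≤ i → u (i + 1) = u i) (d : ℕ) :
    marks r u (N + d) = marks r u N := by
  induction d with
  | zero => rfl
  | succ d ih => rw [← add_assoc, marks, if_pos (h _ (by omega)), ih]

/-- A code of the dyadic number in `[0,1]` that records the mind changes up to stage `i`. -/
noncomputable def marksIndex (r u : ℕ → ℕ) (i : ℕ) : ℕ :=
  Function.surjInv SpaceRep.ratEnum_surjective (dyadic (marks r u i) - 1)

theorem ratEnum_marksIndex (r u : ℕ → ℕ) (i : ℕ) :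
    SpaceRep.ratEnum (marksIndex r u i) = dyadic (marks r u i) - 1 :=
  Function.surjInv_eq SpaceRep.ratEnum_surjective _

theorem continuous_marksIndex (r : ℕ → ℕ) : Continuous (marksIndex r) := by
  rw [← continuousOn_univ]
  refine continuousOn_of_finite_dependence fun u _ i => ⟨i, fun v hv => ?_⟩
  rw [marksIndex, marks_congr hv, marksIndex]

/-- The finite sets of marks increase, and marks added after stage `i` lie beyond `markPos (r ∘ u) i
≥ i`. The `i`-th approximation is therefore within `2 ^ (-i)` of the limit although later mind
changes are unknown. -/
theorem real_names_marksIndex {r u : ℕ → ℕ} {N : ℕ} (h : ∀ i, N ≤ i → u (i + 1) = u i) :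
    SpaceRep.real.Names (Cantor.blocks (marksIndex r u))
      ((dyadic (marks r u N) - 1 : ℚ) : ℝ) := by
  refine ⟨_, rfl, fun i => ?_⟩
  -- With truncated subtraction `i + (N - i)` is the maximum of `i` and `N`.
  have hF : marks r u N = marks r u (i + (N - i)) := by
    rcases le_total i N with hi | hi
    · rw [Nat.add_sub_of_le hi]
    · obtain ⟨d, rfl⟩ := Nat.exists_eq_add_of_le hi
      rw [Nat.sub_eq_zero_of_le hi, add_zero, marks_eq_of_const h]
  obtain ⟨hsub, hlt⟩ := marks_extend r u i (N - i)
  have h1 : dyadic (marks r u N) - 1 - SpaceRep.ratEnum (marksIndex r u i) =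
      dyadic (marks r u (i + (N - i)) \ marks r u i) := by
    rw [ratEnum_marksIndex, ← dyadic_sub_of_subset hsub, hF]
    ring
  have h2 := dyadic_lt (p := i) fun c hc =>
    ((strictMono_markPos (r ∘ u)).id_le i).trans_lt (hlt c hc)
  have h3 : |dyadic (marks r u N) - 1 - SpaceRep.ratEnum (marksIndex r u i)| < 2⁻¹ ^ i := by
    rwa [h1, abs_of_nonneg (dyadic_nonneg _)]
  have h4 := (Rat.cast_lt (K := ℝ)).2 h3
  push_cast at h4 ⊢
  exact h4

/-- The label of a position: the ordinal with the code recorded there. -/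
noncomputable def posLabel (g : ℕ → Ordinal.{0}) (top : Ordinal.{0}) (c : ℕ) : Ordinal.{0} :=
  if c = 0 then top else g (posCode c)

theorem posLabel_markPos (g : ℕ → Ordinal.{0}) (top : Ordinal.{0}) (a : ℕ → ℕ) (i : ℕ) :
    posLabel g top (markPos a i) = g (a i) := by
  rw [posLabel, posCode_markPos, if_neg]
  cases i <;> simp [markPos]

/-- The first conjunct, that the current label is minimal so far, carries the induction for the
second. Position 0 has label `top`, above every `g n`. -/
theorem posLabel_marks {g : ℕ → Ordinal.{0}} {top : Ordinal.{0}} (hg : ∀ n, g n < top)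
    {r u : ℕ → ℕ} (hu : ∀ i, u (i + 1) = u i ∨ g (r (u (i + 1))) < g (r (u i))) (i : ℕ) :
    (∀ c ∈ marks r u i, g (r (u i)) ≤ posLabel g top c) ∧
      ∀ c ∈ marks r u i, ∀ c' ∈ marks r u i, c < c' → posLabel g top c' < posLabel g top c := by
  induction i with
  | zero =>
    have h0 : posLabel g top 0 = top := if_pos rfl
    have h1 := posLabel_markPos g top (r ∘ u) 0
    simp only [Function.comp_apply] at h1
    simp only [marks, Finset.mem_insert, Finset.mem_singleton]
    constructor
    · rintro c (rfl | rfl)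
      · rw [h0]
        exact (hg _).le
      · rw [h1]
    · rintro c (rfl | rfl) c' (rfl | rfl) hlt
      · exact absurd hlt (lt_irrefl _)
      · rw [h0, h1]
        exact hg _
      · exact absurd hlt (Nat.not_lt_zero _)
      · exact absurd hlt (lt_irrefl _)
  | succ i ih =>
    rw [marks]
    split_ifs with h
    · rwa [h]
    · have hlt := (hu i).resolve_left h
      have h1 := posLabel_markPos g top (r ∘ u) (i + 1)
      simp only [Function.comp_apply] at h1
      have hle : ∀ c ∈ marks r u i, c < markPos (r ∘ u) (i + 1) := fun c hc =>
        (le_markPos_of_mem_marks hc).trans_lt (strictMono_markPos _ (Nat.lt_succ_self i))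
      simp only [Finset.mem_insert]
      constructor
      · rintro c (rfl | hc)
        · rw [h1]
        · exact hlt.le.trans (ih.1 c hc)
      · rintro c (rfl | hc) c' (rfl | hc') hcc
        · exact absurd hcc (lt_irrefl _)
        · exact absurd hcc (hle _ hc').le.not_gt
        · rw [h1]
          exact hlt.trans_le (ih.1 c hc)
        · exact ih.2 c hc c' hc' hcc

/-- The last mark reveals only the stage `m` at which it was made, so one needs that the value has
not changed since. -/
theorem exists_last_mark {r u : ℕ → ℕ} {Y : Type} {x : ℕ → Y}
    (h : ∀ i, u (i + 1) = u i → x (i + 1) = x i) (i : ℕ) :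
    ∃ m, markPos (r ∘ u) m ∈ marks r u i ∧ (∀ c ∈ marks r u i, c ≤ markPos (r ∘ u) m) ∧
      x m = x i := by
  induction i with
  | zero => exact ⟨0, by simp [marks], fun c hc => le_markPos_of_mem_marks hc, rfl⟩
  | succ i ih =>
    by_cases hi : u (i + 1) = u i
    · rw [marks, if_pos hi, h i hi]
      exact ih
    · refine ⟨i + 1, ?_, fun c hc => le_markPos_of_mem_marks hc, rfl⟩
      rw [marks, if_neg hi]
      exact Finset.mem_insert_self _ _

/-! ### The reduction -/

theorem contWeihrauchLE_of_searchStops {g : ℕ → Ordinal.{0}} {top : Ordinal.{0}}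
    (hg : ∀ n, g n < top) {b : ℕ → Bool}
    (hb : ∀ n, DecreasingPrefix (posLabel g top) n → b n = true) {f : Set.Icc (0 : ℝ) 1 → ℕ}
    (hf : ∀ x : Set.Icc (0 : ℝ) 1, ∃ k, SearchStops b x k ∧ (∀ j < k, ¬ SearchStops b x j) ∧
      f x = binaryPrefix x k)
    {R : ℕ → ℕ → Prop} {r : ℕ → ℕ} (hr : ∀ m n, R m n → g (r m) < g (r n)) :
    ContWeihrauchLE
      (SpaceRep.nat.prod SpaceRep.baire).seq SpaceRep.baire (LimR R)
      (SpaceRep.real.subspace (Set.Icc (0 : ℝ) 1)) SpaceRep.nat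
      (fun x n => n = f x) := by
  -- The continuity proofs determine the two maps: `K` selects the value at the stage coded by the
  -- length of the answer, and `H` outputs the approximations to the dyadic number.
  refine ⟨_, _, partialContinuous_partialOn
      (Cantor.continuousOn_selectSnd fun n => posStage (Nat.log 2 n)),
    partialContinuous_partialOn
      ((continuous_blocks.comp (continuous_marksIndex r)).comp_continuousOn
        Cantor.continuousOn_decodeFst), fun G hG => ?_⟩
  rintro p s hp ⟨y, hs, N, hN⟩
  have hdec : ∀ i, (p.proj i).left = fun j => decide ((s i).1 ≤ j) := fun i => (hp i).1
  have hu : Cantor.decodeFst p = fun i => (s i).1 := by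
    funext i
    rw [Cantor.decodeFst, hdec, Cantor.firstOne_decide_le]
  set u : ℕ → ℕ := fun i => (s i).1 with hu_def
  have hstep : ∀ i, u (i + 1) = u i ∨ g (r (u (i + 1))) < g (r (u i)) := fun i => by
    by_cases h : (s i).2 = (s (i + 1)).2
    · exact Or.inl ((hs i).2 h).symm
    · exact Or.inr (hr _ _ ((hs i).1 h))
  -- A change of value forces a strict drop of rank, which is impossible while the index stays the
  -- same.
  have hvalue : ∀ i, u (i + 1) = u i → (s (i + 1)).2 = (s i).2 := fun i h => by
    by_contra hne
    have hlt := hr _ _ ((hs i).1 (Ne.symm hne))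
    change g (r (u (i + 1))) < g (r (u i)) at hlt
    rw [h] at hlt
    exact lt_irrefl _ hlt
  have hconst : ∀ i, N ≤ i → u (i + 1) = u i := fun i hi =>
    ((hs i).2 ((hN i hi).trans (hN (i + 1) (by omega)).symm)).symm
  obtain ⟨m, hm, hmax, hxm⟩ := exists_last_mark (r := r) (x := fun i => (s i).2) hvalue N
  have h0 := zero_mem_marks r u N
  obtain ⟨hx0, hx1⟩ := dyadic_sub_one_mem h0
  let x : Set.Icc (0 : ℝ) 1 := ⟨((dyadic (marks r u N) - 1 : ℚ) : ℝ), hx0, hx1.le⟩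
  have hstops := searchStops_dyadic hb h0 (posLabel_marks hg hstep N).2 hm hmax
  -- The logarithm is the length of the shortest stopping prefix; this is the position of the last
  -- mark, where the search stops for the first time.
  have hfx : Nat.log 2 (f x) = markPos (r ∘ u) m := by
    obtain ⟨k, hk, hkmin, hfk⟩ := hf x
    rw [hfk, log_binaryPrefix hx0 hx1]
    refine le_antisymm (not_lt.1 fun h => hkmin _ h (hstops 0).2) (not_lt.1 fun h => ?_)
    exact (hstops k).1 h hk
  have hname : (SpaceRep.real.subspace (Set.Icc (0 : ℝ) 1)).Names
      (Cantor.blocks (marksIndex r (Cantor.decodeFst p))) x := by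
    rw [hu]
    exact real_names_marksIndex hconst
  obtain ⟨q, hq, n, hqn, rfl⟩ := hG _ x hname ⟨_, rfl⟩
  have hright : (Cantor.pair p q).right = fun j => decide (f x ≤ j) := by
    rw [Cantor.right_pair]
    exact hqn
  refine ⟨Cantor.selectSnd (fun n => posStage (Nat.log 2 n)) (Cantor.pair p q), ?_, y, ?_,
    hs, N, hN⟩
  · refine Part.mem_bind_iff.2 ⟨_, mem_partialOn fun i => ⟨(s i).1, ?_⟩,
      Part.mem_bind_iff.2 ⟨q, hq, mem_partialOn ⟨f x, ?_⟩⟩⟩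
    · rw [hdec]
      simp
    · rw [hright]
      simp
  · rw [Cantor.selectSnd, hright, Cantor.firstOne_decide_le, Cantor.left_pair, hfx,
      posStage_markPos, ← hN N le_rfl, ← hxm]
    exact (hp m).2

theorem exists_ordinal_enumeration (α : Ordinal.{0}) (hα : α.card ≤ Cardinal.aleph0) :
    ∃ g : ℕ → Ordinal.{0}, Set.range g = Set.Iio (α + 1) := by
  have hc : (Set.Iio (α + 1)).Countable := by
    rw [← Cardinal.le_aleph0_iff_set_countable, Cardinal.mk_Iio_ordinal, Cardinal.lift_le_aleph0]
    simpa using hα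
  obtain ⟨g, hg⟩ := hc.exists_eq_range ⟨α, by simp⟩
  exact ⟨g, hg.symm⟩

theorem rank_lt_of_relRank_eq {R : ℕ → ℕ → Prop} [IsWellFounded ℕ R] {o : Ordinal.{0}}
    (h : relRank R = o) (n : ℕ) : IsWellFounded.rank R n < o := by
  rw [← h, ← Order.succ_le_iff]
  exact Ordinal.le_iSup (fun n => Order.succ (IsWellFounded.rank R n)) n

theorem mainTheorem8 (α : Ordinal.{0}) (hα : α.card ≤ Cardinal.aleph0) :
    ∃ f : Set.Icc (0 : ℝ) 1 → ℕ,
      BSSComputable f ∧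
      ∀ (R : ℕ → ℕ → Prop) [IsTrans ℕ R] [IsWellFounded ℕ R], relRank R = α + 1 →
        ContWeihrauchLE
          (SpaceRep.nat.prod SpaceRep.baire).seq SpaceRep.baire (LimR R)
          (SpaceRep.real.subspace (Set.Icc (0 : ℝ) 1)) SpaceRep.nat
          (fun x n => n = f x) := by
  classical
  obtain ⟨g, hg⟩ := exists_ordinal_enumeration α hα
  have hlt : ∀ n, g n < α + 1 := fun n => by
    have : g n ∈ Set.Iio (α + 1) := hg ▸ Set.mem_range_self n
    exact this
  -- This set need not be computable; it reaches the machine only as a real constant.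
  let b : ℕ → Bool := fun n => decide (DecreasingPrefix (posLabel g (α + 1)) n)
  have hex : ∀ x : Set.Icc (0 : ℝ) 1, ∃ k, SearchStops b x k := fun x =>
    exists_searchStops (L := posLabel g (α + 1)) (fun n hn => of_decide_eq_true hn) x.2
  let f : Set.Icc (0 : ℝ) 1 → ℕ := fun x => binaryPrefix x (Nat.find (hex x))
  have hf : ∀ x : Set.Icc (0 : ℝ) 1, ∃ k, SearchStops b x k ∧ (∀ j < k, ¬ SearchStops b x j) ∧
      f x = binaryPrefix x k := fun x =>
    ⟨Nat.find (hex x), Nat.find_spec (hex x), fun j hj => Nat.find_min (hex x) hj, rfl⟩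
  refine ⟨f, bssComputable_of_searchStops b f hf, fun R _ _ hR => ?_⟩
  have hcode : ∀ n, ∃ c, g c = IsWellFounded.rank R n := fun n => by
    have : IsWellFounded.rank R n ∈ Set.range g := hg ▸ rank_lt_of_relRank_eq hR n
    exact this
  -- `r` translates elements of `R` into codes of their ranks under the fixed enumeration `g`.
  choose r hr using hcode
  refine contWeihrauchLE_of_searchStops hlt (fun n hn => decide_eq_true hn) hf (r := r)
    fun m n hmn => ?_
  rw [hr, hr]
  exact IsWellFounded.rank_lt_of_rel hmn
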